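/- **Conventions.** A category $\mathcal C$ has the *amalgamation property* (AP) if every diagram of shape $\bullet\leftarrow\bullet\to\bullet$ in $\mathcal C$ has a cocone, and the *joint embedding property* (JEP) if every diagram of finite discrete shape (the empty shape included) in $\mathcal C$ has a cocone. An *inverse category* is a category in which every morphism $f:X\to Y$ has a unique pseudoinverse $f^{-1}:Y\to X$, i.e. a morphism with $ff^{-1}f=f$ and $f^{-1}ff^{-1}=f^{-1}$. For a category $\mathcal I$, let $\eta:\mathcal I\to\mathcal L(\mathcal I)$ be the inverse category freely generated by $\mathcal I$ subject to $\eta(i)^{-1}\circ\eta(i)=1$ for every morphism $i$ of $\mathcal I$; $\mathcal I$ is *upward-simply-connected* if every endomorphism $f$ in $\mathcal L(\mathcal I)$ satisfies $f\circ f=f$. The *monic reflection* $\mathcal M(\mathcal I)$ is $\mathcal I/{\sim}$ for the least congruence $\sim$ on $\mathcal I$ such that every morphism of $\mathcal I/{\sim}$ is monic. The finite *tree-like* posets are defined inductively, up to isomorphism: if $K_1,\dots,K_n$ ($n\ge 0$) are finite tree-like posets and $U_k\subseteq K_k$ is a connected (in particular nonempty) upward-closed subset for each $k$, then the disjoint union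 of the $K_k$ together with one new point lying below exactly the elements of $U_1\cup\dots\cup U_n$ and itself is tree-like. A finite *forest-like* poset is a disjoint union of finitely many tree-like posets. A finite category is given explicitly by its number of objects, the list of its morphisms with their sources and targets, and a composition table. **Corollary 6.1 (decidability).** There are algorithms that, given any finite category $\mathcal I$ explicitly, decide 1. whether $\mathcal I$ is upward-simply-connected; the same algorithm decides whether every $\mathcal I$-shaped diagram in a category with the AP and the JEP has a cocone; 2. whether every $\mathcal I$-shaped diagram in a category with the AP has a cocone. Moreover, a finite category $\mathcal I$ is upward-simply-connected if and only if $\mathcal M(\mathcal I)$ is a preorder and the poset equivalent to $\mathcal M(\mathcal I)$ is forest-like. -/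

import Mathlib

open CategoryTheory CategoryTheory.Limits

universe w w' u v

/-! ### Amalgamation and joint embedding -/

/-- The amalgamation property: every diagram of shape `• ← • → •` has a cocone. -/
def HasAP (C : Type u) [Category.{v} C] : Prop :=
  ∀ F : WalkingSpan ⥤ C, Nonempty (Cocone F)

/-- The joint embedding property: every diagram of finite discrete shape has a cocone.
The empty shape is included, so a category with this property is nonempty. -/
def HasJEP (C : Type u) [Category.{v} C] : Prop :=
  ∀ (n : ℕ) (F : Discrete (Fin n) ⥤ C), Nonempty (Cocone F)

/-- Every `I`-shaped diagram in a category with the AP and the JEP has a cocone. -/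
def CoconesFromAPJEP (I : Type w) [Category.{w'} I] : Prop :=
  ∀ (C : Type u) [Category.{v} C], HasAP C → HasJEP C → ∀ F : I ⥤ C, Nonempty (Cocone F)

/-- Every `I`-shaped diagram in a category with the AP has a cocone. -/
def CoconesFromAP (I : Type w) [Category.{w'} I] : Prop :=
  ∀ (C : Type u) [Category.{v} C], HasAP C → ∀ F : I ⥤ C, Nonempty (Cocone F)

/-! ### Inverse categories and the left fundamental inverse category -/

/-- `g` is a pseudoinverse of `f`. -/
def IsPseudoinverse {C : Type u} [Category.{v} C] {X Y : C} (f : X ⟶ Y) (g : Y ⟶ X) : Prop :=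
  f ≫ g ≫ f = f ∧ g ≫ f ≫ g = g

/-- An inverse category: every morphism has a unique pseudoinverse. -/
def IsInverseCategory (C : Type u) [Category.{v} C] : Prop :=
  ∀ ⦃X Y : C⦄ (f : X ⟶ Y), ∃! g : Y ⟶ X, IsPseudoinverse f g

/-- An idempotent category: every endomorphism is idempotent. -/
def IsIdempotentCategory (C : Type u) [Category.{v} C] : Prop :=
  ∀ (X : C) (f : X ⟶ X), f ≫ f = f

/-- Formal expressions built from the morphisms of `I` with identities, composition (in
diagrammatic order) and formal pseudoinverses. -/
inductive InvTerm (I : Type w) [Category.{w'} I] : I → I → Type (max w w')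
  | of {X Y : I} (i : X ⟶ Y) : InvTerm I X Y
  | id (X : I) : InvTerm I X X
  | comp {X Y Z : I} (f : InvTerm I X Y) (g : InvTerm I Y Z) : InvTerm I X Z
  | inv {X Y : I} (f : InvTerm I X Y) : InvTerm I Y X

/-- The least congruence on formal expressions that contains the laws of inverse categories, the
relations that hold in `I`, and the relations `i⁻¹ ∘ i = 1` for the morphisms `i` of `I`. -/
inductive InvTerm.Rel {I : Type w} [Category.{w'} I] :
    ∀ {X Y : I}, InvTerm I X Y → InvTerm I X Y → Prop
  | refl {X Y : I} (f : InvTerm I X Y) : Rel f f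
  | symm {X Y : I} {f g : InvTerm I X Y} : Rel f g → Rel g f
  | trans {X Y : I} {f g h : InvTerm I X Y} : Rel f g → Rel g h → Rel f h
  | comp_congr {X Y Z : I} {f f' : InvTerm I X Y} {g g' : InvTerm I Y Z} :
      Rel f f' → Rel g g' → Rel (f.comp g) (f'.comp g')
  | inv_congr {X Y : I} {f f' : InvTerm I X Y} : Rel f f' → Rel f.inv f'.inv
  | id_comp {X Y : I} (f : InvTerm I X Y) : Rel ((InvTerm.id X).comp f) f
  | comp_id {X Y : I} (f : InvTerm I X Y) : Rel (f.comp (InvTerm.id Y)) f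
  | assoc {W X Y Z : I} (f : InvTerm I W X) (g : InvTerm I X Y) (h : InvTerm I Y Z) :
      Rel ((f.comp g).comp h) (f.comp (g.comp h))
  | inv_inv {X Y : I} (f : InvTerm I X Y) : Rel f.inv.inv f
  | inv_comp {X Y Z : I} (f : InvTerm I X Y) (g : InvTerm I Y Z) :
      Rel (f.comp g).inv (g.inv.comp f.inv)
  | regular {X Y : I} (f : InvTerm I X Y) : Rel (f.comp (f.inv.comp f)) f
  | idem_comm {X Y Z : I} (f : InvTerm I X Y) (g : InvTerm I X Z) :
      Rel ((f.comp f.inv).comp (g.comp g.inv)) ((g.comp g.inv).comp (f.comp f.inv))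
  | of_id (X : I) : Rel (InvTerm.of (𝟙 X)) (InvTerm.id X)
  | of_comp {X Y Z : I} (i : X ⟶ Y) (j : Y ⟶ Z) :
      Rel (InvTerm.of (i ≫ j)) ((InvTerm.of i).comp (InvTerm.of j))
  | of_mono {X Y : I} (i : X ⟶ Y) : Rel ((InvTerm.of i).comp (InvTerm.of i).inv) (InvTerm.id X)

/-- The congruence as a setoid on each set of parallel expressions. -/
def InvTerm.setoid {I : Type w} [Category.{w'} I] (X Y : I) : Setoid (InvTerm I X Y) where
  r := InvTerm.Rel
  iseqv := ⟨.refl, .symm, .trans⟩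

/-- The objects of the left fundamental inverse category of `I`: those of `I`. -/
structure LeftFundInv (I : Type w) [Category.{w'} I] : Type w where
  as : I

/-- The left fundamental inverse category of `I`: the inverse category freely generated by `I`
such that every morphism of `I` becomes monic. -/
instance LeftFundInv.category (I : Type w) [Category.{w'} I] :
    Category.{max w w'} (LeftFundInv I) where
  Hom X Y := _root_.Quotient (InvTerm.setoid X.as Y.as)
  id X := Quotient.mk _ (InvTerm.id X.as)
  comp f g := Quotient.map₂ InvTerm.comp (fun _ _ h _ _ h' => InvTerm.Rel.comp_congr h h') f g
  id_comp f := Quotient.inductionOn f fun f => Quotient.sound (InvTerm.Rel.id_comp f)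
  comp_id f := Quotient.inductionOn f fun f => Quotient.sound (InvTerm.Rel.comp_id f)
  assoc f g h := Quotient.inductionOn₃ f g h fun f g h => Quotient.sound (InvTerm.Rel.assoc f g h)

/-- The canonical functor from `I` to its left fundamental inverse category. -/
def LeftFundInv.η (I : Type w) [Category.{w'} I] : I ⥤ LeftFundInv I where
  obj X := ⟨X⟩
  map i := Quotient.mk _ (InvTerm.of i)
  map_id X := Quotient.sound (InvTerm.Rel.of_id X)
  map_comp i j := Quotient.sound (InvTerm.Rel.of_comp i j)

/-- `I` is upward-simply-connected if its left fundamental inverse category is idempotent. -/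
def UpwardSimplyConnected (I : Type w) [Category.{w'} I] : Prop :=
  IsIdempotentCategory (LeftFundInv I)

/-! ### The universal property of the left fundamental inverse category -/

/-- In an inverse category, idempotents commute. -/
theorem IsInverseCategory.idem_comm {C : Type u} [Category.{v} C] (hC : IsInverseCategory C)
    {X : C} (e f : X ⟶ X) (he : e ≫ e = e) (hf : f ≫ f = f) : e ≫ f = f ≫ e := by
  have key : ∀ e f : X ⟶ X, e ≫ e = e → f ≫ f = f → (e ≫ f) ≫ (e ≫ f) = e ≫ f := by
    intro e f he hf
    have he' : ∀ {Z : C} (h : X ⟶ Z), e ≫ e ≫ h = e ≫ h := fun h => by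
      rw [← Category.assoc, he]
    have hf' : ∀ {Z : C} (h : X ⟶ Z), f ≫ f ≫ h = f ≫ h := fun h => by
      rw [← Category.assoc, hf]
    obtain ⟨x, ⟨h1, h2⟩, hu⟩ := hC (e ≫ f)
    simp only [Category.assoc] at h1 h2
    have h2' : ∀ {Z : C} (h : X ⟶ Z), x ≫ e ≫ f ≫ x ≫ h = x ≫ h := fun h => by
      have := congrArg (· ≫ h) h2
      simpa only [Category.assoc] using this
    have hx : f ≫ x ≫ e = x := by
      refine hu _ ⟨?_, ?_⟩
      · simp only [Category.assoc, hf', he']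
        exact h1
      · simp only [Category.assoc, hf', he', h2']
    have hxx : x ≫ x = x := by
      calc x ≫ x = (f ≫ x ≫ e) ≫ (f ≫ x ≫ e) := by rw [hx]
        _ = f ≫ x ≫ e := by simp only [Category.assoc, h2']
        _ = x := hx
    obtain ⟨y, _, hy⟩ := hC x
    have a1 : e ≫ f = y := hy _ ⟨by simpa only [Category.assoc] using h2,
      by simpa only [Category.assoc] using h1⟩
    have a2 : x = y := hy _ ⟨by rw [hxx, hxx], by rw [hxx, hxx]⟩
    rw [a1, ← a2, hxx]
  have h1 := key e f he hf
  have h2 := key f e hf he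
  have he' : ∀ {Z : C} (h : X ⟶ Z), e ≫ e ≫ h = e ≫ h := fun h => by
    rw [← Category.assoc, he]
  have hf' : ∀ {Z : C} (h : X ⟶ Z), f ≫ f ≫ h = f ≫ h := fun h => by
    rw [← Category.assoc, hf]
  simp only [Category.assoc] at h1 h2
  obtain ⟨y, _, hy⟩ := hC (e ≫ f)
  have a1 : e ≫ f = y := hy _ ⟨by simp only [Category.assoc, h1], by simp only [Category.assoc, h1]⟩
  have a2 : f ≫ e = y := hy _ ⟨by simp only [Category.assoc, hf', he', h1],
    by simp only [Category.assoc, hf', he', h2]⟩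
  rw [a1, a2]

/-- The left fundamental inverse category is an inverse category. -/
theorem LeftFundInv.isInverseCategory (I : Type w) [Category.{w'} I] :
    IsInverseCategory (LeftFundInv I) := by
  let star : ∀ {X Y : LeftFundInv I}, (X ⟶ Y) → (Y ⟶ X) := fun f =>
    Quotient.map InvTerm.inv (fun _ _ h => InvTerm.Rel.inv_congr h) f
  have reg : ∀ {X Y : LeftFundInv I} (f : X ⟶ Y), f ≫ star f ≫ f = f := fun f =>
    Quotient.inductionOn f fun f => Quotient.sound (InvTerm.Rel.regular f)
  have inv : ∀ {X Y : LeftFundInv I} (f : X ⟶ Y), star (star f) = f := fun f =>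
    Quotient.inductionOn f fun f => Quotient.sound (InvTerm.Rel.inv_inv f)
  have invc : ∀ {X Y Z : LeftFundInv I} (f : X ⟶ Y) (g : Y ⟶ Z),
      star (f ≫ g) = star g ≫ star f := fun f g =>
    Quotient.inductionOn₂ f g fun f g => Quotient.sound (InvTerm.Rel.inv_comp f g)
  have comm : ∀ {X Y Z : LeftFundInv I} (f : X ⟶ Y) (g : X ⟶ Z),
      (f ≫ star f) ≫ (g ≫ star g) = (g ≫ star g) ≫ (f ≫ star f) := fun f g =>
    Quotient.inductionOn₂ f g fun f g => Quotient.sound (InvTerm.Rel.idem_comm f g)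
  have reg' : ∀ {X Y : LeftFundInv I} (f : X ⟶ Y), star f ≫ f ≫ star f = star f := fun f => by
    simpa only [inv] using reg (star f)
  -- idempotents are self-adjoint
  have sa : ∀ {X : LeftFundInv I} (e : X ⟶ X), e ≫ e = e → star e = e := by
    intro X e he
    have hs : star e ≫ star e = star e := by rw [← invc, he]
    have h1 := comm e (star e)
    simp only [inv, Category.assoc] at h1
    have h2 : e ≫ star e = star e ≫ e := by
      have hse : ∀ {Z : LeftFundInv I} (h : X ⟶ Z), star e ≫ star e ≫ h = star e ≫ h :=
        fun h => by rw [← Category.assoc, hs]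
      have hee : ∀ {Z : LeftFundInv I} (h : X ⟶ Z), e ≫ e ≫ h = e ≫ h :=
        fun h => by rw [← Category.assoc, he]
      rw [hse, hee] at h1
      rw [reg] at h1
      rw [reg'] at h1
      have h3 : star e = e := h1.symm
      rw [h3]
    calc star e = star e ≫ e ≫ star e := (reg' e).symm
      _ = star e ≫ star e ≫ e := by rw [h2]
      _ = e ≫ star e := by rw [← Category.assoc, hs, h2]
      _ = (e ≫ e) ≫ star e := by rw [he]
      _ = e ≫ star e ≫ e := by rw [Category.assoc, h2]
      _ = e := reg e
  have comm' : ∀ {X : LeftFundInv I} (e f : X ⟶ X), e ≫ e = e → f ≫ f = f → e ≫ f = f ≫ e := by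
    intro X e f he hf
    have := comm e f
    rwa [sa e he, sa f hf, he, hf] at this
  have uniq : ∀ {X Y : LeftFundInv I} (f : X ⟶ Y) (g h : Y ⟶ X), IsPseudoinverse f g →
      IsPseudoinverse f h → g = h := by
    rintro X Y f g h ⟨g1, g2⟩ ⟨h1, h2⟩
    have i1 : (f ≫ g) ≫ (f ≫ g) = f ≫ g := by rw [Category.assoc, g2]
    have i2 : (f ≫ h) ≫ (f ≫ h) = f ≫ h := by rw [Category.assoc, h2]
    have i3 : (g ≫ f) ≫ (g ≫ f) = g ≫ f := by rw [Category.assoc, g1]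
    have i4 : (h ≫ f) ≫ (h ≫ f) = h ≫ f := by rw [Category.assoc, h1]
    have c1 := comm' _ _ i1 i2
    have c2 := comm' _ _ i3 i4
    have hfgh : f ≫ g = f ≫ h := by
      calc f ≫ g = (f ≫ h ≫ f) ≫ g := by rw [h1]
        _ = (f ≫ h) ≫ (f ≫ g) := by simp only [Category.assoc]
        _ = (f ≫ g) ≫ (f ≫ h) := c1.symm
        _ = (f ≫ g ≫ f) ≫ h := by simp only [Category.assoc]
        _ = f ≫ h := by rw [g1]
    have hgfh : g ≫ f = h ≫ f := by
      calc g ≫ f = g ≫ (f ≫ h ≫ f) := by rw [h1]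
        _ = (g ≫ f) ≫ (h ≫ f) := by simp only [Category.assoc]
        _ = (h ≫ f) ≫ (g ≫ f) := c2
        _ = h ≫ (f ≫ g ≫ f) := by simp only [Category.assoc]
        _ = h ≫ f := by rw [g1]
    calc g = g ≫ f ≫ g := g2.symm
      _ = g ≫ f ≫ h := by rw [hfgh]
      _ = (g ≫ f) ≫ h := by rw [Category.assoc]
      _ = (h ≫ f) ≫ h := by rw [hgfh]
      _ = h := by rw [Category.assoc, h2]
  intro X Y f
  exact ⟨star f, ⟨reg f, reg' f⟩, fun g hg => uniq f g _ hg ⟨reg f, reg' f⟩⟩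

/-- Every morphism of `I` becomes (split) monic in the left fundamental inverse category. -/
theorem LeftFundInv.η_mono (I : Type w) [Category.{w'} I] {X Y : I} (i : X ⟶ Y)
    (g : (LeftFundInv.η I).obj Y ⟶ (LeftFundInv.η I).obj X)
    (hg : IsPseudoinverse ((LeftFundInv.η I).map i) g) :
    (LeftFundInv.η I).map i ≫ g = 𝟙 _ := by
  let s : (LeftFundInv.η I).obj Y ⟶ (LeftFundInv.η I).obj X :=
    Quotient.mk (InvTerm.setoid Y X) (InvTerm.of i).inv
  have hs : (LeftFundInv.η I).map i ≫ s = 𝟙 _ := Quotient.sound (InvTerm.Rel.of_mono i)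
  have : g = s := (LeftFundInv.isInverseCategory I _).unique hg
    ⟨by rw [← Category.assoc, hs, Category.id_comp], by rw [hs, Category.comp_id]⟩
  rw [this, hs]

/-- The universal property: every functor from `I` to an inverse category that turns all morphisms
into (split) monomorphisms extends uniquely along `η`. -/
theorem LeftFundInv.existsUnique_lift (I : Type w) [Category.{w'} I] (C : Type u) [Category.{v} C]
    (hC : IsInverseCategory C) (F : I ⥤ C)
    (hF : ∀ {X Y : I} (i : X ⟶ Y) (g : F.obj Y ⟶ F.obj X),
      IsPseudoinverse (F.map i) g → F.map i ≫ g = 𝟙 _) :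
    ∃! G : LeftFundInv I ⥤ C, LeftFundInv.η I ⋙ G = F := by
  choose star hstar hu using fun {X Y : C} (f : X ⟶ Y) => hC f
  have reg : ∀ {X Y : C} (f : X ⟶ Y), f ≫ star f ≫ f = f := fun f => (hstar f).1
  have reg' : ∀ {X Y : C} (f : X ⟶ Y), star f ≫ f ≫ star f = star f := fun f => (hstar f).2
  have inv : ∀ {X Y : C} (f : X ⟶ Y), star (star f) = f := fun f =>
    (hu (star f) f ⟨reg' f, reg f⟩).symm
  have idl : ∀ {X Y : C} (f : X ⟶ Y), (f ≫ star f) ≫ (f ≫ star f) = f ≫ star f := fun f => by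
    rw [Category.assoc, reg']
  have idr : ∀ {X Y : C} (f : X ⟶ Y), (star f ≫ f) ≫ (star f ≫ f) = star f ≫ f := fun f => by
    rw [Category.assoc, reg]
  have invc : ∀ {X Y Z : C} (f : X ⟶ Y) (g : Y ⟶ Z), star (f ≫ g) = star g ≫ star f := by
    intro X Y Z f g
    have c := hC.idem_comm _ _ (idr f) (idl g)
    refine (hu _ _ ⟨?_, ?_⟩).symm
    · calc (f ≫ g) ≫ (star g ≫ star f) ≫ f ≫ g
          = f ≫ ((g ≫ star g) ≫ (star f ≫ f)) ≫ g := by simp only [Category.assoc]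
        _ = f ≫ ((star f ≫ f) ≫ (g ≫ star g)) ≫ g := by rw [c]
        _ = (f ≫ star f ≫ f) ≫ (g ≫ star g ≫ g) := by simp only [Category.assoc]
        _ = f ≫ g := by rw [reg, reg]
    · calc (star g ≫ star f) ≫ (f ≫ g) ≫ star g ≫ star f
          = star g ≫ ((star f ≫ f) ≫ (g ≫ star g)) ≫ star f := by simp only [Category.assoc]
        _ = star g ≫ ((g ≫ star g) ≫ (star f ≫ f)) ≫ star f := by rw [c]
        _ = (star g ≫ g ≫ star g) ≫ (star f ≫ f ≫ star f) := by simp only [Category.assoc]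
        _ = star g ≫ star f := by rw [reg', reg']
  let ev : ∀ {X Y : I}, InvTerm I X Y → (F.obj X ⟶ F.obj Y) := fun {X Y} t =>
    InvTerm.rec (motive := fun X Y _ => F.obj X ⟶ F.obj Y) (fun i => F.map i) (fun X => 𝟙 _)
      (fun _ _ f g => f ≫ g) (fun _ f => star f) t
  have evs : ∀ {X Y : I} (s t : InvTerm I X Y), InvTerm.Rel s t → ev s = ev t := by
    intro X Y s t h
    induction h with
    | refl f => rfl
    | symm _ ih => exact ih.symm
    | trans _ _ ih ih' => exact ih.trans ih'
    | comp_congr _ _ ih ih' => exact congrArg₂ (· ≫ ·) ih ih'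
    | inv_congr _ ih => exact congrArg (fun f => star f) ih
    | id_comp f => exact Category.id_comp _
    | comp_id f => exact Category.comp_id _
    | assoc f g h => exact Category.assoc _ _ _
    | inv_inv f => exact inv _
    | inv_comp f g => exact invc _ _
    | regular f => exact reg _
    | idem_comm f g => exact hC.idem_comm _ _ (idl _) (idl _)
    | of_id X => exact F.map_id X
    | of_comp i j => exact F.map_comp i j
    | of_mono i => exact hF i _ (hstar _)
  let G : LeftFundInv I ⥤ C :=
    { obj := fun X => F.obj X.as
      map := fun {X Y} f => Quotient.lift (s := InvTerm.setoid X.as Y.as)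
        (fun t => ev t) (fun s t h => evs s t h) f
      map_id := fun X => rfl
      map_comp := fun f g => Quotient.inductionOn₂ f g fun f g => rfl }
  refine ⟨G, rfl, ?_⟩
  rintro H rfl
  let cl : ∀ {X Y : I}, InvTerm I X Y → ((⟨X⟩ : LeftFundInv I) ⟶ ⟨Y⟩) :=
    fun {X Y} t => Quotient.mk (InvTerm.setoid X Y) t
  have key : ∀ {X Y : I} (t : InvTerm I X Y), H.map (cl t) = ev t := by
    intro X Y t
    induction t with
    | of i => rfl
    | id X => exact H.map_id ⟨X⟩
    | comp f g ihf ihg =>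
      exact (H.map_comp (cl f) (cl g)).trans (congrArg₂ (· ≫ ·) ihf ihg)
    | inv f ih =>
      have h1 : cl f ≫ cl f.inv ≫ cl f = cl f := Quotient.sound (InvTerm.Rel.regular f)
      have h2 : cl f.inv ≫ cl f ≫ cl f.inv = cl f.inv := Quotient.sound
        (.trans (.comp_congr (.refl _) (.comp_congr (.symm (.inv_inv f)) (.refl _)))
          (InvTerm.Rel.regular f.inv))
      have h3 : H.map (cl f.inv) = star (H.map (cl f)) :=
        hu _ _ ⟨by rw [← H.map_comp, ← H.map_comp, h1], by rw [← H.map_comp, ← H.map_comp, h2]⟩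
      exact h3.trans (congrArg (fun f => star f) ih)
  refine CategoryTheory.Functor.hext (fun X => rfl) ?_
  rintro ⟨X⟩ ⟨Y⟩ f
  exact heq_of_eq (Quotient.inductionOn f fun t => key t)

/-! ### The monic reflection -/

/-- The least congruence on `I` whose quotient category is monic. -/
def monicRel (I : Type w) [Category.{w'} I] : HomRel I := fun X Y f g =>
  ∀ r : HomRel I, Congruence r →
    (∀ ⦃A B : CategoryTheory.Quotient r⦄ (h : A ⟶ B), Mono h) → @r X Y f g

/-- The monic reflection of `I`. -/
abbrev MonicReflection (I : Type w) [Category.{w'} I] : Type w :=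
  CategoryTheory.Quotient (monicRel I)

/-! ### Tree-like and forest-like posets -/

/-- The disjoint union of the posets `K k` with one further point adjoined, which lies below the
upward-closed subset `U k` of each `K k` (and below no other point of the `K k`). -/
structure AdjoinPoint {n : ℕ} (K : Fin n → Type w) [∀ k, PartialOrder (K k)]
    (U : ∀ k, UpperSet (K k)) : Type w where
  toOption : Option (Σ k, K k)

instance AdjoinPoint.partialOrder {n : ℕ} (K : Fin n → Type w) [∀ k, PartialOrder (K k)]
    (U : ∀ k, UpperSet (K k)) : PartialOrder (AdjoinPoint K U) where
  le a b := match a, b with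
    | ⟨none⟩, ⟨none⟩ => True
    | ⟨none⟩, ⟨some y⟩ => y.2 ∈ U y.1
    | ⟨some _⟩, ⟨none⟩ => False
    | ⟨some x⟩, ⟨some y⟩ => x ≤ y
  le_refl := by rintro ⟨_ | x⟩ <;> simp
  le_trans := by
    rintro ⟨_ | x⟩ ⟨_ | y⟩ ⟨_ | z⟩ h1 h2 <;> try trivial
    · obtain ⟨k, y, z, hyz⟩ := h2
      exact (U k).upper hyz h1
    · exact le_trans (α := Σ k, K k) h1 h2
  le_antisymm := by
    rintro ⟨_ | x⟩ ⟨_ | y⟩ h1 h2 <;> try trivial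
    exact congrArg (fun s => AdjoinPoint.mk (some s)) (le_antisymm (α := Σ k, K k) h1 h2)

/-- Finite tree-like posets, up to isomorphism: given finitely many tree-like posets `K k` and
connected (in particular nonempty) upward-closed subsets `U k` of them, the disjoint union of the
`K k` with a point adjoined below the `U k` is tree-like. -/
inductive TreeLike : ∀ (P : Type w) [PartialOrder P], Prop
  | adjoin {n : ℕ} (K : Fin n → Type w) [∀ k, PartialOrder (K k)] (U : ∀ k, UpperSet (K k))
      (hK : ∀ k, TreeLike (K k)) (hU : ∀ k, CategoryTheory.IsConnected {x : K k // x ∈ U k})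
      (P : Type w) [PartialOrder P] (e : P ≃o AdjoinPoint K U) : TreeLike P

/-- Finite forest-like posets: finite disjoint unions of tree-like posets. -/
def ForestLike (P : Type w) [PartialOrder P] : Prop :=
  ∃ (n : ℕ) (K : Fin n → Type w) (_ : ∀ k, PartialOrder (K k)),
    (∀ k, TreeLike (K k)) ∧ Nonempty (P ≃o Σ k, K k)

/-! ### Explicitly given finite categories -/

/-- Finite data describing a finite category: the number of objects, the list of the morphisms
(each given by the numbers of its source and of its target), and a composition table. -/
abbrev CatTable : Type := ℕ × List (ℕ × ℕ) × List (List ℕ)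

/-- `c` is a description of the category `I`: after a numbering of the objects and of the morphisms
of `I`, the list in `c` gives the source and the target of each morphism, and for composable
morphisms `f : X ⟶ Y` and `g : Y ⟶ Z` the entry of the table in the row of `f` and the column of `g`
is the number of the composite (other entries are arbitrary or absent). -/
structure CatTable.Presentation (c : CatTable) (I : Type w) [Category.{w'} I] where
  obj : I ≃ Fin c.1
  arr : (Σ X Y : I, X ⟶ Y) ≃ Fin c.2.1.length
  endpoints : ∀ {X Y : I} (f : X ⟶ Y), c.2.1.get (arr ⟨X, Y, f⟩) = ((obj X : ℕ), (obj Y : ℕ))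
  comp : ∀ {X Y Z : I} (f : X ⟶ Y) (g : Y ⟶ Z),
    (c.2.2[(arr ⟨X, Y, f⟩ : ℕ)]?.bind fun row => row[(arr ⟨Y, Z, g⟩ : ℕ)]?) =
      some (arr ⟨X, Z, f ≫ g⟩ : ℕ)

/-- Every category with finitely many objects and morphisms has a description. -/
theorem CatTable.exists_presentation (I : Type w) [Category.{w'} I] [Finite I]
    [∀ X Y : I, Finite (X ⟶ Y)] : ∃ c : CatTable, Nonempty (c.Presentation I) := by
  classical
  obtain ⟨n, ⟨eo⟩⟩ := Finite.exists_equiv_fin I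
  obtain ⟨m, ⟨ea⟩⟩ := Finite.exists_equiv_fin (Σ X Y : I, X ⟶ Y)
  let ends : (Σ X Y : I, X ⟶ Y) → ℕ × ℕ := fun p => (eo p.1, eo p.2.1)
  let num : (Σ X Y : I, X ⟶ Y) → (Σ X Y : I, X ⟶ Y) → ℕ := fun p q =>
    if h : p.2.1 = q.1 then ea ⟨p.1, q.2.1, p.2.2 ≫ eqToHom h ≫ q.2.2⟩ else 0
  let arrows : List (ℕ × ℕ) := List.ofFn fun a : Fin m => ends (ea.symm a)
  have hm : m = arrows.length := (List.length_ofFn).symm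
  let table : List (List ℕ) := List.ofFn fun a => List.ofFn fun b => num (ea.symm a) (ea.symm b)
  refine ⟨(n, arrows, table), ⟨⟨eo, ea.trans (finCongr hm), ?_, ?_⟩⟩⟩
  · intro X Y f
    have h : arrows.get (finCongr hm (ea ⟨X, Y, f⟩)) = ends (ea.symm (ea ⟨X, Y, f⟩)) := by
      simp [arrows]
    rw [Equiv.symm_apply_apply] at h
    exact h
  · intro X Y Z f g
    have h : (table[(ea ⟨X, Y, f⟩ : ℕ)]?.bind fun row => row[(ea ⟨Y, Z, g⟩ : ℕ)]?) =
        some (num (ea.symm (ea ⟨X, Y, f⟩)) (ea.symm (ea ⟨Y, Z, g⟩))) := by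
      simp [table, -Equiv.symm_apply_apply]
    rw [Equiv.symm_apply_apply, Equiv.symm_apply_apply] at h
    simpa [num] using h

universe t

/-!
The subsets of an infinite set, with injections, form a category with the AP and the JEP. A diagram
of sets and injections with a cocone of injections has no monodromy: transport along a closed zigzag
of `I` is the identity wherever it is defined. The morphisms of `L(I)` act on such diagrams by
partial injections, and `X ↦ Hom(A, η X)` is itself such a diagram, so `I` is
upward-simply-connected if and only if these diagrams have no monodromy.

In the absence of monodromy the Hom functors of the monic reflection show that it is thin, and
double covers, with the sheets exchanged over a clopen part of the objects strictly above `p`, show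
that distinct components of `{z | p < z}` lie in distinct components of `{z | ¬ z ≤ p}`. A finite
poset with this property is forest-like: remove a minimal element and induct. Conversely, cocones
over a forest-like diagram of monomorphisms are built by induction on the forest, and the AP reduces
arbitrary diagrams to these, since it makes eventual equality of morphisms a congruence whose
quotient has only monomorphisms.

Thinness and the property of the components quantify only over the finitely many relations on the
morphisms and the finitely many sets of objects, so they are decidable. With the AP alone, cocones
exist if and only if in addition `I` is connected, as shown by diagrams in discrete categories.
-/

/-! ### Clopen extension and forest-like posets -/

section ClopenExtension

variable {α β : Type*}

/-- The set `S` is a union of connected components of the subset `A` of a relation `r`, that is, it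
is clopen in `A` for the Alexandrov topology. Only the trace of `S` on `A` matters. -/
def ClopenOn (r : α → α → Prop) (A S : Set α) : Prop :=
  ∀ x ∈ A, ∀ y ∈ A, r x y → (x ∈ S ↔ y ∈ S)

/-- Every clopen part of the points strictly above `p` extends to a clopen part of the points that
are not below `p`: distinct components of `{z | p < z}` lie in distinct components of
`{z | ¬ z ≤ p}`. Among finite posets this characterizes the forest-like ones. -/
def ExtendsClopens (r : α → α → Prop) : Prop :=
  ∀ p S, ClopenOn r {z | r p z ∧ ¬ r z p} S →
    ∃ T, ClopenOn r {z | ¬ r z p} T ∧ ∀ z, r p z → ¬ r z p → (z ∈ T ↔ z ∈ S)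

theorem ExtendsClopens.of_surjective {r : α → α → Prop} {s : β → β → Prop}
    (h : ExtendsClopens r) {q : α → β} (hq : Function.Surjective q)
    (hqr : ∀ x y, s (q x) (q y) ↔ r x y) : ExtendsClopens s := by
  obtain ⟨g, hg⟩ := hq.hasRightInverse
  have hgr : ∀ x y, r (g x) (g y) ↔ s x y := fun x y => by rw [← hqr, hg, hg]
  intro p S hS
  have hpr : ∀ x, r (g p) x ↔ s p (q x) := fun x => by rw [← hqr, hg]
  have hrp : ∀ x, r x (g p) ↔ s (q x) p := fun x => by rw [← hqr, hg]
  obtain ⟨T, hT, hTS⟩ := h (g p) (q ⁻¹' S) fun x hx y hy hxy =>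
    hS _ ⟨(hpr x).1 hx.1, mt (hrp x).2 hx.2⟩ _ ⟨(hpr y).1 hy.1, mt (hrp y).2 hy.2⟩ ((hqr x y).2 hxy)
  refine ⟨g ⁻¹' T, fun x hx y hy hxy =>
    hT _ (mt (hgr x p).1 hx) _ (mt (hgr y p).1 hy) ((hgr x y).2 hxy), fun z hpz hzp => ?_⟩
  rw [Set.mem_preimage, hTS (g z) ((hgr p z).2 hpz) (mt (hgr z p).1 hzp), Set.mem_preimage, hg]

variable {P : Type w} [PartialOrder P] {Q : Type*} [PartialOrder Q]

theorem ExtendsClopens.of_upperEmbedding (h : ExtendsClopens ((· ≤ ·) : P → P → Prop))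
    (j : Q ↪o P) (hj : IsUpperSet (Set.range j)) : ExtendsClopens ((· ≤ ·) : Q → Q → Prop) := by
  intro p S hS
  obtain ⟨T, hT, hTS⟩ := h (j p) (j '' S) (by
    rintro _ ⟨hx, hx'⟩ _ ⟨hy, hy'⟩ hxy
    obtain ⟨x, rfl⟩ := hj hx ⟨p, rfl⟩
    obtain ⟨y, rfl⟩ := hj hy ⟨p, rfl⟩
    simp only [j.le_iff_le, j.injective.mem_set_image] at *
    exact hS x ⟨hx, hx'⟩ y ⟨hy, hy'⟩ hxy)
  refine ⟨j ⁻¹' T, fun x hx y hy hxy => hT _ (mt j.le_iff_le.1 hx) _ (mt j.le_iff_le.1 hy)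
    (j.le_iff_le.2 hxy), fun z hpz hzp => ?_⟩
  rw [Set.mem_preimage, hTS _ (j.le_iff_le.2 hpz) (mt j.le_iff_le.1 hzp),
    j.injective.mem_set_image]

/-- The set of connected components of a poset. -/
abbrev PosetComponents (P : Type w) [PartialOrder P] : Type w :=
  CategoryTheory.ConnectedComponents P

/-- The connected component of an element of a poset. -/
abbrev PosetComponents.mk (x : P) : PosetComponents P := CategoryTheory.ConnectedComponents.mk x

/-- A connected component of a poset, with the induced order. -/
abbrev PosetComponent (P : Type w) [PartialOrder P] (i : PosetComponents P) : Type w :=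
  {x : P // PosetComponents.mk x = i}

instance PosetComponent.isConnected (i : PosetComponents P) :
    CategoryTheory.IsConnected (PosetComponent P i) := by
  have : Nonempty (PosetComponent P i) := by
    obtain ⟨x, hx⟩ := Quotient.exists_rep i
    exact ⟨⟨x, hx⟩⟩
  let F : i.Component ⥤ PosetComponent P i :=
    { obj := fun x => ⟨x.obj, x.property⟩
      map := fun f => homOfLE (leOfHom f.hom) }
  exact zigzag_isConnected fun x y =>
    zigzag_obj_of_zigzag F (isPreconnected_zigzag ⟨x.1, x.2⟩ ⟨y.1, y.2⟩)

theorem PosetComponents.mk_eq_mk {x y : P} (h : x ≤ y) :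
    PosetComponents.mk x = PosetComponents.mk y :=
  Quotient.sound (s := Zigzag.setoid P) (Zigzag.of_hom (homOfLE h))

theorem PosetComponent.isUpperSet_range (i : PosetComponents P) :
    IsUpperSet (Set.range (OrderEmbedding.subtype fun x : P => PosetComponents.mk x = i)) := by
  rintro _ y hxy ⟨x, rfl⟩
  exact ⟨⟨y, (PosetComponents.mk_eq_mk hxy).symm.trans x.2⟩, rfl⟩

theorem PosetComponent.sigma_le_iff {n : ℕ} (e : PosetComponents P ≃ Fin n)
    (a b : Σ k, PosetComponent P (e.symm k)) : a ≤ b ↔ a.2.1 ≤ b.2.1 := by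
  obtain ⟨k, y, hy⟩ := a
  obtain ⟨l, z, hz⟩ := b
  refine ⟨fun ⟨_, _, _, h⟩ => h, fun h => ?_⟩
  obtain rfl : k = l := e.symm.injective (hy.symm.trans ((PosetComponents.mk_eq_mk h).trans hz))
  exact Sigma.LE.fiber _ _ _ h

/-- A poset with finitely many components is their disjoint union. -/
noncomputable def PosetComponent.sigmaIso {n : ℕ} (e : PosetComponents P ≃ Fin n) :
    (Σ k, PosetComponent P (e.symm k)) ≃o P where
  toEquiv := Equiv.ofBijective (fun a => a.2.1) <| by
    refine ⟨?_, fun x => ⟨⟨e (PosetComponents.mk x), x, by simp⟩, rfl⟩⟩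
    rintro ⟨k, y, hy⟩ ⟨l, z, hz⟩ (rfl : y = z)
    obtain rfl : k = l := e.symm.injective (hy.symm.trans hz)
    rfl
  map_rel_iff' {a b} := (sigma_le_iff e a b).symm

theorem PosetComponent.exists_equiv_fin [Finite P] :
    ∃ n : ℕ, Nonempty (PosetComponents P ≃ Fin n) :=
  have : Finite (PosetComponents P) := Quotient.finite _
  Finite.exists_equiv_fin _

theorem TreeLike.of_isMin [Finite P] {p : P} (hp : IsMin p)
    (hK : ∀ i, TreeLike (PosetComponent {x : P // x ≠ p} i))
    (hU : ∀ i, CategoryTheory.IsConnected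
      {x : PosetComponent {x : P // x ≠ p} i // p ≤ x.1.1}) :
    TreeLike P := by
  obtain ⟨n, ⟨e⟩⟩ := PosetComponent.exists_equiv_fin (P := {x : P // x ≠ p})
  let K : Fin n → Type w := fun k => PosetComponent {x : P // x ≠ p} (e.symm k)
  let U : ∀ k, UpperSet (K k) := fun k => ⟨{x | p ≤ x.1.1}, fun x y hxy hx => le_trans hx hxy⟩
  let s := PosetComponent.sigmaIso e
  let g : AdjoinPoint K U → P := fun a => a.toOption.elim p fun x => (s x).1
  have hg : Function.Bijective g := by
    constructor
    · rintro ⟨_ | x⟩ ⟨_ | y⟩ h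
      · rfl
      · exact absurd h.symm (s y).2
      · exact absurd h (s x).2
      · rw [s.injective (Subtype.ext h : s x = s y)]
    · intro x
      by_cases hx : x = p
      · exact ⟨⟨none⟩, hx.symm⟩
      · exact ⟨⟨some (s.symm ⟨x, hx⟩)⟩, by simp [g]⟩
  have hle : ∀ a b, g a ≤ g b ↔ a ≤ b := by
    rintro ⟨_ | x⟩ ⟨_ | y⟩
    · exact iff_of_true le_rfl trivial
    · exact Iff.rfl
    · exact iff_of_false (fun h => (s x).2 (hp.eq_of_le h)) id
    · exact s.le_iff_le
  exact TreeLike.adjoin K U (fun k => hK _) (fun k => hU _) P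
    (OrderIso.symm ⟨Equiv.ofBijective g hg, fun {a b} => hle a b⟩)

/-- Otherwise the component would be a component of the whole poset. -/
theorem PosetComponent.exists_ge_of_isMin [CategoryTheory.IsConnected P] {p : P} (hp : IsMin p)
    (i : PosetComponents {x : P // x ≠ p}) :
    ∃ x : PosetComponent {x : P // x ≠ p} i, p ≤ x.1.1 := by
  by_contra! h
  obtain ⟨x⟩ : Nonempty (PosetComponent {x : P // x ≠ p} i) := inferInstance
  let S : Set P := {z | ∃ hz : z ≠ p, PosetComponents.mk (⟨z, hz⟩ : {x : P // x ≠ p}) = i}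
  obtain ⟨hpp, -⟩ : p ∈ S := induct_on_objects S (j₀ := x.1.1) ⟨x.1.2, x.2⟩ (fun {y z} f => by
    have hyz : y ≤ z := leOfHom f
    have hmk hy hz := PosetComponents.mk_eq_mk
      (show (⟨y, hy⟩ : {x : P // x ≠ p}) ≤ ⟨z, hz⟩ from hyz)
    constructor
    · rintro ⟨hy, hyi⟩
      have hz : z ≠ p := fun e => hy (hp.eq_of_le (e ▸ hyz))
      exact ⟨hz, (hmk hy hz).symm.trans hyi⟩
    · rintro ⟨hz, hzi⟩
      have hy : y ≠ p := fun e => h ⟨⟨z, hz⟩, hzi⟩ (e ▸ hyz)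
      exact ⟨hy, (hmk hy hz).trans hzi⟩) p
  exact hpp rfl

/-- A clopen part of the points of the component above `p` extends to a clopen part of the
complement of `p`, which is everything or nothing on the component. -/
theorem ExtendsClopens.isConnected_ge_of_isMin [CategoryTheory.IsConnected P]
    (h : ExtendsClopens ((· ≤ ·) : P → P → Prop)) {p : P} (hp : IsMin p)
    (i : PosetComponents {x : P // x ≠ p}) :
    CategoryTheory.IsConnected {x : PosetComponent {x : P // x ≠ p} i // p ≤ x.1.1} := by
  obtain ⟨u, hu⟩ := PosetComponent.exists_ge_of_isMin hp i
  have : Nonempty {x : PosetComponent {x : P // x ≠ p} i // p ≤ x.1.1} := ⟨⟨u, hu⟩⟩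
  refine IsConnected.of_induct (j₀ := ⟨u, hu⟩) fun S₀ huS hS₀ v => ?_
  let S : Set P := (fun x => x.1.1.1) '' S₀
  have hS : ∀ x : {x : PosetComponent {x : P // x ≠ p} i // p ≤ x.1.1}, x.1.1.1 ∈ S ↔ x ∈ S₀ :=
    fun x => Function.Injective.mem_set_image
      ((Subtype.val_injective.comp Subtype.val_injective).comp Subtype.val_injective)
  have hne : ∀ z : P, ¬ z ≤ p ↔ z ≠ p := fun z => not_congr ⟨hp.eq_of_le, le_of_eq⟩
  have hSup : ClopenOn (· ≤ ·) {z : P | p ≤ z ∧ ¬ z ≤ p} S := by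
    intro x hx y hy hxy
    have hx' := (hne x).1 hx.2
    have hy' := (hne y).1 hy.2
    have hmk := PosetComponents.mk_eq_mk
      (show (⟨x, hx'⟩ : {x : P // x ≠ p}) ≤ ⟨y, hy'⟩ from hxy)
    by_cases hi : PosetComponents.mk ⟨x, hx'⟩ = i
    · let x' : {x : PosetComponent {x : P // x ≠ p} i // p ≤ x.1.1} := ⟨⟨⟨x, hx'⟩, hi⟩, hx.1⟩
      let y' : {x : PosetComponent {x : P // x ≠ p} i // p ≤ x.1.1} :=
        ⟨⟨⟨y, hy'⟩, hmk.symm.trans hi⟩, hy.1⟩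
      exact ((hS x').trans (hS₀ (homOfLE (show x' ≤ y' from hxy)))).trans (hS y').symm
    · refine iff_of_false ?_ ?_
      · rintro ⟨x', -, rfl⟩
        exact hi x'.1.2
      · rintro ⟨y', -, rfl⟩
        exact hi (hmk.trans y'.1.2)
  obtain ⟨T, hT, hTS⟩ := h p S hSup
  have hTv : v.1.1.1 ∈ T := induct_on_objects {x : PosetComponent {x : P // x ≠ p} i | x.1.1 ∈ T}
    (j₀ := u) ((hTS _ hu ((hne _).2 u.1.2)).2 ((hS ⟨u, hu⟩).2 huS))
    (fun {x y} f => hT _ ((hne _).2 x.1.2) _ ((hne _).2 y.1.2) (leOfHom f)) v.1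
  exact (hS v).1 ((hTS _ v.2 ((hne _).2 v.1.1.2)).1 hTv)

theorem TreeLike.of_extendsClopens (P : Type w) [PartialOrder P] [Finite P]
    [CategoryTheory.IsConnected P] (h : ExtendsClopens ((· ≤ ·) : P → P → Prop)) : TreeLike P := by
  induction hn : Nat.card P using Nat.strong_induction_on generalizing P with
  | _ n ih =>
    subst hn
    obtain ⟨p, hp⟩ := exists_minimal_of_wellFoundedLT (fun _ : P => True)
      ⟨IsConnected.is_nonempty.some, trivial⟩
    rw [minimal_true] at hp
    have hupper : IsUpperSet (Set.range (OrderEmbedding.subtype fun x : P => x ≠ p)) := by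
      rintro _ y hxy ⟨x, rfl⟩
      exact ⟨⟨y, fun hy => x.2 (hp.eq_of_le (hy ▸ hxy))⟩, rfl⟩
    refine TreeLike.of_isMin hp (fun i => ih _ ?_ _ ?_ rfl) (h.isConnected_ge_of_isMin hp)
    · exact (Nat.card_le_card_of_injective _ Subtype.val_injective).trans_lt
        (Finite.card_subtype_lt (x := p) fun h => h rfl)
    · exact (h.of_upperEmbedding (OrderEmbedding.subtype _) hupper).of_upperEmbedding
        (OrderEmbedding.subtype _) (PosetComponent.isUpperSet_range i)

theorem ForestLike.of_extendsClopens [Finite P] (h : ExtendsClopens ((· ≤ ·) : P → P → Prop)) :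
    ForestLike P := by
  obtain ⟨n, ⟨e⟩⟩ := PosetComponent.exists_equiv_fin (P := P)
  exact ⟨n, fun k => PosetComponent P (e.symm k), inferInstance, fun k =>
    TreeLike.of_extendsClopens _
      (h.of_upperEmbedding (OrderEmbedding.subtype _) (PosetComponent.isUpperSet_range _)),
    ⟨(PosetComponent.sigmaIso e).symm⟩⟩

end ClopenExtension

/-! ### Cocones over forest-like diagrams -/

section Amalgamation

variable {C : Type u} [Category.{v} C]

theorem HasAP.exists_comp_eq (hC : HasAP C) {X Y Z : C} (f : X ⟶ Y) (g : X ⟶ Z) :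
    ∃ (W : C) (h : Y ⟶ W) (k : Z ⟶ W), f ≫ h = g ≫ k := by
  obtain ⟨c⟩ := hC (span f g)
  exact ⟨c.pt, c.ι.app WalkingSpan.left, c.ι.app WalkingSpan.right,
    (c.w WalkingSpan.Hom.fst).trans (c.w WalkingSpan.Hom.snd).symm⟩

theorem hasAP_of_exists (h : ∀ {X Y Z : C} (f : X ⟶ Y) (g : X ⟶ Z),
    ∃ (W : C) (h : Y ⟶ W) (k : Z ⟶ W), f ≫ h = g ≫ k) : HasAP C := by
  intro F
  obtain ⟨W, a, b, hab⟩ := h (F.map WalkingSpan.Hom.fst) (F.map WalkingSpan.Hom.snd)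
  exact ⟨(Cocone.precompose (diagramIsoSpan F).hom).obj (PushoutCocone.mk a b hab)⟩

theorem HasJEP.exists_hom (hC : HasJEP C) {n : ℕ} (X : Fin n → C) :
    ∃ W : C, ∀ k, Nonempty (X k ⟶ W) := by
  obtain ⟨c⟩ := hC n (Discrete.functor X)
  exact ⟨c.pt, fun k => ⟨c.ι.app ⟨k⟩⟩⟩

theorem hasJEP_of_exists (h : ∀ (n : ℕ) (X : Fin n → C), ∃ W : C, ∀ k, Nonempty (X k ⟶ W)) :
    HasJEP C := by
  intro n F
  obtain ⟨W, hW⟩ := h n fun k => F.obj ⟨k⟩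
  exact ⟨⟨W, Discrete.natTrans fun k => (hW k.as).some⟩⟩

theorem HasAP.exists_wide (hC : HasAP C) {ι : Type*} [Finite ι] {X : C} {Y : ι → C}
    (f : ∀ k, X ⟶ Y k) : ∃ (W : C) (p : X ⟶ W) (g : ∀ k, Y k ⟶ W), ∀ k, f k ≫ g k = p := by
  classical
  cases nonempty_fintype ι
  have key : ∀ s : Finset ι, ∃ (W : C) (p : X ⟶ W), ∀ k ∈ s, ∃ g : Y k ⟶ W, f k ≫ g = p := by
    intro s
    induction s using Finset.induction_on with
    | empty => exact ⟨X, 𝟙 X, by simp⟩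
    | insert a s _ ih =>
      obtain ⟨W, p, hp⟩ := ih
      obtain ⟨W', a', b', hab⟩ := hC.exists_comp_eq p (f a)
      refine ⟨W', p ≫ a', fun k hk => ?_⟩
      rcases Finset.mem_insert.1 hk with rfl | hk
      · exact ⟨b', hab.symm⟩
      · obtain ⟨g, hg⟩ := hp k hk
        exact ⟨g ≫ a', by rw [← Category.assoc, hg]⟩
  obtain ⟨W, p, hp⟩ := key Finset.univ
  choose g hg using fun k => hp k (Finset.mem_univ k)
  exact ⟨W, p, g, hg⟩

theorem nonempty_cocone_of_orderIso {P Q : Type w} [PartialOrder P] [PartialOrder Q] (e : P ≃o Q)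
    (F : P ⥤ C) {W : C} (φ : ∀ a : Q, F.obj (e.symm a) ⟶ W)
    (hφ : ∀ (a b : Q) (h : a ≤ b), F.map (homOfLE (e.symm.monotone h)) ≫ φ b = φ a) :
    Nonempty (Cocone F) := by
  refine ⟨⟨W, ⟨fun x => F.map (homOfLE (e.symm_apply_apply x).ge) ≫ φ (e x), fun x y f => ?_⟩⟩⟩
  have h := hφ (e x) (e y) (e.monotone (leOfHom f))
  simp only [Functor.const_obj_obj, Functor.const_obj_map, Category.comp_id]
  rw [← h, ← Category.assoc, ← Category.assoc, ← F.map_comp, ← F.map_comp]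
  rfl

theorem TreeLike.nonempty_cocone {P : Type w} [PartialOrder P] (hP : TreeLike P) (hC : HasAP C)
    (F : P ⥤ C) : Nonempty (Cocone F) := by
  induction hP with
  | @adjoin n K _ U _ hU P _ e ih =>
    have hin : ∀ k, Monotone fun x : K k => e.symm (⟨some ⟨k, x⟩⟩ : AdjoinPoint K U) :=
      fun k x y hxy => e.symm.monotone (show (⟨k, x⟩ : Σ k, K k) ≤ ⟨k, y⟩ from .fiber _ _ _ hxy)
    have c := fun k => (ih k ((hin k).functor ⋙ F)).some
    have hpt : ∀ k (x : {x : K k // x ∈ U k}),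
        e.symm (⟨none⟩ : AdjoinPoint K U) ≤ e.symm ⟨some ⟨k, x.1⟩⟩ :=
      fun k x => e.symm.monotone (show x.1 ∈ U k from x.2)
    let q : ∀ k, {x : K k // x ∈ U k} → (F.obj (e.symm ⟨none⟩) ⟶ (c k).pt) :=
      fun k x => F.map (homOfLE (hpt k x)) ≫ (c k).ι.app x.1
    have hq : ∀ k x y, q k x = q k y := fun k => by
      have := hU k
      refine constant_of_preserves_morphisms (q k) fun x y f => ?_
      have hw := (c k).w (homOfLE (show x.1 ≤ y.1 from leOfHom f))
      refine (congrArg (F.map (homOfLE (hpt k x)) ≫ ·) hw.symm).trans ?_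
      exact (Category.assoc _ _ _).symm.trans (congrArg (· ≫ _) (F.map_comp _ _).symm)
    have x₀ := fun k => (hU k).is_nonempty.some
    obtain ⟨W, p, g, hg⟩ := hC.exists_wide fun k => q k (x₀ k)
    refine nonempty_cocone_of_orderIso e F (W := W) (fun a => match a with
      | ⟨none⟩ => p
      | ⟨some ⟨k, x⟩⟩ => (c k).ι.app x ≫ g k) ?_
    rintro ⟨_ | x⟩ ⟨_ | ⟨k, y⟩⟩ h
    · exact (congrArg (· ≫ p) (F.map_id _)).trans (Category.id_comp _)
    · change F.map _ ≫ (c k).ι.app y ≫ g k = p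
      rw [← hg k, hq k (x₀ k) ⟨y, h⟩, ← Category.assoc]
      rfl
    · exact h.elim
    · obtain ⟨_, x, _, h'⟩ := h
      change F.map _ ≫ (c k).ι.app y ≫ g k = (c k).ι.app x ≫ g k
      rw [← (c k).w (homOfLE h')]
      exact (Category.assoc _ _ _).symm

theorem ForestLike.nonempty_cocone {P : Type w} [PartialOrder P] (hP : ForestLike P)
    (hC : HasAP C) (hC' : HasJEP C) (F : P ⥤ C) : Nonempty (Cocone F) := by
  obtain ⟨n, K, _, hK, ⟨e⟩⟩ := hP
  have hin : ∀ k, Monotone fun x : K k => e.symm ⟨k, x⟩ :=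
    fun k x y hxy => e.symm.monotone (.fiber _ _ _ hxy)
  have c := fun k => ((hK k).nonempty_cocone hC ((hin k).functor ⋙ F)).some
  obtain ⟨W, hW⟩ := hC'.exists_hom fun k => (c k).pt
  refine nonempty_cocone_of_orderIso e F (W := W) (fun a => (c a.1).ι.app a.2 ≫ (hW a.1).some) ?_
  rintro _ _ ⟨k, x, y, h⟩
  rw [← (c k).w (homOfLE h)]
  exact (Category.assoc _ _ _).symm

/-- Two morphisms are eventually equal if they have a common postcomposite. -/
def eventuallyEq (C : Type u) [Category.{v} C] : HomRel C :=
  fun _ Y f g => ∃ (Z : C) (h : Y ⟶ Z), f ≫ h = g ≫ h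

theorem HasAP.congruence_eventuallyEq (hC : HasAP C) : Congruence (eventuallyEq C) where
  equivalence := by
    refine ⟨fun f => ⟨_, 𝟙 _, rfl⟩, fun ⟨Z, h, e⟩ => ⟨Z, h, e.symm⟩, ?_⟩
    rintro f g k ⟨Z, h, e⟩ ⟨Z', h', e'⟩
    obtain ⟨W, a, b, hab⟩ := hC.exists_comp_eq h h'
    refine ⟨W, h ≫ a, ?_⟩
    rw [← Category.assoc, e, Category.assoc, hab, ← Category.assoc, e', Category.assoc]
  comp_left := by
    rintro _ _ _ f g g' ⟨Z, h, e⟩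
    exact ⟨Z, h, by rw [Category.assoc, e, Category.assoc]⟩
  comp_right := by
    rintro _ _ _ f f' g ⟨Z, h, e⟩
    obtain ⟨W, a, b, hab⟩ := hC.exists_comp_eq h g
    refine ⟨W, b, ?_⟩
    rw [Category.assoc, ← hab, ← Category.assoc, e, Category.assoc, hab, Category.assoc]

/-- The quotient of `C` by eventual equality, which is the monic reflection of `C` when `C` has the
amalgamation property. -/
abbrev EventualQuotient (C : Type u) [Category.{v} C] := CategoryTheory.Quotient (eventuallyEq C)

/-- The canonical functor to the quotient by eventual equality. -/
abbrev toEventualQuotient (C : Type u) [Category.{v} C] : C ⥤ EventualQuotient C :=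
  CategoryTheory.Quotient.functor _

theorem forall_mono_quotient_iff (r : HomRel C) [Congruence r] :
    (∀ ⦃A B : CategoryTheory.Quotient r⦄ (h : A ⟶ B), Mono h) ↔
      ∀ ⦃X Y Z : C⦄ (f g : X ⟶ Y) (h : Y ⟶ Z), r (f ≫ h) (g ≫ h) → r f g := by
  let q := CategoryTheory.Quotient.functor r
  have hq : ∀ {X Y : C} (f g : X ⟶ Y), q.map f = q.map g ↔ r f g :=
    CategoryTheory.Quotient.functor_map_eq_iff r
  constructor
  · intro hm X Y Z f g h e
    have := hm (q.map h)
    rw [← hq] at e ⊢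
    rwa [q.map_comp, q.map_comp, cancel_mono] at e
  · rintro hr ⟨A⟩ ⟨B⟩ h
    obtain ⟨h, rfl⟩ := q.map_surjective (X := A) (Y := B) h
    refine ⟨fun {Z} a b e => ?_⟩
    obtain ⟨a, rfl⟩ := q.map_surjective (X := Z.as) (Y := A) a
    obtain ⟨b, rfl⟩ := q.map_surjective (X := Z.as) (Y := A) b
    exact (hq a b).2 (hr a b h
      ((hq _ _).1 ((q.map_comp a h).trans (e.trans (q.map_comp b h).symm))))

theorem HasAP.eventualQuotient_mono (hC : HasAP C) ⦃X Y : EventualQuotient C⦄ (f : X ⟶ Y) :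
    Mono f :=
  have := hC.congruence_eventuallyEq
  (forall_mono_quotient_iff (eventuallyEq C)).2 (fun _ _ _ f g h ⟨W, k, e⟩ =>
    ⟨W, h ≫ k, by rw [← Category.assoc, e, Category.assoc]⟩) f

theorem HasAP.eventualQuotient (hC : HasAP C) : HasAP (EventualQuotient C) := by
  refine hasAP_of_exists fun {X Y Z} f g => ?_
  obtain ⟨f, rfl⟩ := (toEventualQuotient C).map_surjective (X := X.as) (Y := Y.as) f
  obtain ⟨g, rfl⟩ := (toEventualQuotient C).map_surjective (X := X.as) (Y := Z.as) g
  obtain ⟨W, h, k, e⟩ := hC.exists_comp_eq f g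
  exact ⟨⟨W⟩, (toEventualQuotient C).map h, (toEventualQuotient C).map k,
    congrArg (toEventualQuotient C).map e⟩

theorem HasJEP.eventualQuotient (hC : HasJEP C) : HasJEP (EventualQuotient C) := by
  refine hasJEP_of_exists fun n X => ?_
  obtain ⟨W, hW⟩ := hC.exists_hom fun k => (X k).as
  exact ⟨⟨W⟩, fun k => ⟨(toEventualQuotient C).map (hW k).some⟩⟩

theorem HasAP.nonempty_cocone_of_eventualQuotient (hC : HasAP C) {I : Type w} [Category.{w'} I]
    [Finite (Σ X Y : I, X ⟶ Y)] (F : I ⥤ C)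
    (h : Nonempty (Cocone (F ⋙ toEventualQuotient C))) : Nonempty (Cocone F) := by
  have := hC.congruence_eventuallyEq
  obtain ⟨c⟩ := h
  choose φ hφ using fun X => (toEventualQuotient C).map_surjective
    (X := F.obj X) (Y := c.pt.as) (c.ι.app X)
  have hev : ∀ a : Σ X Y : I, X ⟶ Y, eventuallyEq C (F.map a.2.2 ≫ φ a.2.1) (φ a.1) := by
    intro a
    refine (CategoryTheory.Quotient.functor_map_eq_iff (eventuallyEq C) _ _).1 ?_
    rw [Functor.map_comp, hφ, hφ]
    exact c.w a.2.2
  choose Z h e using hev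
  obtain ⟨W, p, g, hg⟩ := hC.exists_wide h
  refine ⟨⟨W, ⟨fun X => φ X ≫ p, fun X Y f => ?_⟩⟩⟩
  simp only [Functor.const_obj_obj, Functor.const_obj_map, Category.comp_id]
  rw [← hg ⟨X, Y, f⟩, ← Category.assoc, ← Category.assoc, e ⟨X, Y, f⟩, Category.assoc]

end Amalgamation

section MonicReflection

variable {I : Type w} [Category.{w'} I]

instance monicRel.congruence : Congruence (monicRel I) where
  equivalence := ⟨fun f _ hr _ => hr.equivalence.refl f,
    fun h r hr hm => hr.equivalence.symm (h r hr hm),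
    fun h h' r hr hm => hr.equivalence.trans (h r hr hm) (h' r hr hm)⟩
  comp_left f _ _ h r hr hm := hr.comp_left f (h r hr hm)
  comp_right g h r hr hm := hr.comp_right g (h r hr hm)

/-- The canonical functor to the monic reflection. -/
abbrev toMonicReflection (I : Type w) [Category.{w'} I] : I ⥤ MonicReflection I :=
  CategoryTheory.Quotient.functor _

instance MonicReflection.mono {X Y : MonicReflection I} (f : X ⟶ Y) : Mono f :=
  (forall_mono_quotient_iff (monicRel I)).2
    (fun _ _ _ f g h e r hr hm => (forall_mono_quotient_iff r).1 hm f g h (e r hr hm)) f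

theorem monicRel.map_eq {D : Type u} [Category.{v} D] (hD : ∀ ⦃A B : D⦄ (h : A ⟶ B), Mono h)
    (G : I ⥤ D) {X Y : I} {f g : X ⟶ Y} (h : monicRel I f g) : G.map f = G.map g := by
  refine h G.homRel inferInstance ((forall_mono_quotient_iff _).2 fun _ _ _ a b k e => ?_)
  have := hD (G.map k)
  rw [Functor.homRel_iff, G.map_comp, G.map_comp, cancel_mono] at e
  exact e

theorem MonicReflection.isThin_iff : Quiver.IsThin (MonicReflection I) ↔
    ∀ ⦃X Y : I⦄ (f g : X ⟶ Y), monicRel I f g := by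
  refine ⟨fun h X Y f g => (CategoryTheory.Quotient.functor_map_eq_iff (monicRel I) f g).1
    ((h _ _).elim _ _), fun h => fun X Y => ⟨fun f g => ?_⟩⟩
  obtain ⟨f, rfl⟩ := (toMonicReflection I).map_surjective (X := X.as) (Y := Y.as) f
  obtain ⟨g, rfl⟩ := (toMonicReflection I).map_surjective (X := X.as) (Y := Y.as) g
  exact CategoryTheory.Quotient.sound _ (h f g)

/-- The canonical functor to the poset equivalent to the monic reflection. -/
def toMonicSkeleton (I : Type w) [Category.{w'} I] : I ⥤ ThinSkeleton (MonicReflection I) :=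
  toMonicReflection I ⋙ toThinSkeleton _

theorem toMonicSkeleton_surjective : Function.Surjective (toMonicSkeleton I).obj := by
  rintro ⟨X⟩
  exact ⟨X.as, rfl⟩

theorem toMonicSkeleton_le_iff (X Y : I) :
    (toMonicSkeleton I).obj X ≤ (toMonicSkeleton I).obj Y ↔ Nonempty (X ⟶ Y) :=
  ⟨fun ⟨f⟩ => ⟨((toMonicReflection I).map_surjective (X := X) (Y := Y) f).choose⟩,
    fun ⟨f⟩ => leOfHom ((toMonicSkeleton I).map f)⟩

theorem isConnected_of_functor_surjective {J : Type u} [Category.{v} J]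
    [CategoryTheory.IsConnected I] (F : I ⥤ J) (hF : Function.Surjective F.obj) :
    CategoryTheory.IsConnected J := by
  have : Nonempty J := ⟨F.obj IsConnected.is_nonempty.some⟩
  refine zigzag_isConnected (hF.forall₂.2 fun X Y => ?_)
  exact zigzag_obj_of_zigzag F (isPreconnected_zigzag X Y)

theorem HasAP.nonempty_cocone_of_thinSkeleton {C : Type u} [Category.{v} C] (hC : HasAP C)
    [Finite (Σ X Y : I, X ⟶ Y)] [Quiver.IsThin (MonicReflection I)]
    (h : ∀ G : ThinSkeleton (MonicReflection I) ⥤ EventualQuotient C, Nonempty (Cocone G))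
    (F : I ⥤ C) : Nonempty (Cocone F) := by
  apply hC.nonempty_cocone_of_eventualQuotient
  let G := F ⋙ toEventualQuotient C
  let H : MonicReflection I ⥤ EventualQuotient C := CategoryTheory.Quotient.lift (monicRel I) G
    fun _ _ _ _ hfg => hfg.map_eq hC.eventualQuotient_mono G
  obtain ⟨c⟩ := h (ThinSkeleton.fromThinSkeleton _ ⋙ H)
  have e : toMonicReflection I ⋙ H = G := CategoryTheory.Quotient.lift_spec _ _ _
  change Nonempty (Cocone G)
  rw [← e]
  exact ⟨((Functor.Final.extendCocone (F := ThinSkeleton.fromThinSkeleton _)).obj c).whisker _⟩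

theorem CoconesFromAPJEP.of_forestLike [Finite (Σ X Y : I, X ⟶ Y)]
    [Quiver.IsThin (MonicReflection I)] (h : ForestLike (ThinSkeleton (MonicReflection I))) :
    CoconesFromAPJEP.{w, w', u, v} I := fun _ _ hC hC' F =>
  hC.nonempty_cocone_of_thinSkeleton
    (fun G => h.nonempty_cocone hC.eventualQuotient hC'.eventualQuotient G) F

theorem CoconesFromAP.of_treeLike [Finite (Σ X Y : I, X ⟶ Y)]
    [Quiver.IsThin (MonicReflection I)] (h : TreeLike (ThinSkeleton (MonicReflection I))) :
    CoconesFromAP.{w, w', u, v} I := fun _ _ hC F =>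
  hC.nonempty_cocone_of_thinSkeleton (fun G => h.nonempty_cocone hC.eventualQuotient G) F

end MonicReflection

/-! ### Monodromy -/

section Monodromy

variable {I : Type w} [Category.{w'} I]

theorem rel_of_zigzag {r : I → I → Prop} (hr : Equivalence r)
    (h : ∀ {X Y : I}, (X ⟶ Y) → r X Y) {X Y : I} (hz : Zigzag X Y) : r X Y := by
  induction hz with
  | refl => exact hr.refl _
  | tail _ hz ih => exact hr.trans ih (hz.elim (fun ⟨f⟩ => h f) fun ⟨f⟩ => hr.symm (h f))

/-- A set-valued functor has trivial monodromy if transport along a closed path of `I`, wherever it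
is defined, is the identity: every connected component of the category of elements has at most one
point over each object. -/
def TrivialMonodromy (F : I ⥤ Type t) : Prop :=
  ∀ ⦃X : I⦄ (a b : F.obj X), Zigzag (F.elementsMk X a) (F.elementsMk X b) → a = b

/-- No diagram of countable sets and injections of shape `I` has monodromy. -/
def NoMonodromy (I : Type w) [Category.{w'} I] : Prop :=
  ∀ F : I ⥤ Type w', (∀ ⦃X Y : I⦄ (f : X ⟶ Y), Function.Injective (F.map f)) →
    (∀ X, Countable (F.obj X)) → TrivialMonodromy F

theorem TrivialMonodromy.of_injective_cocone {F : I ⥤ Type t} {β : Type*}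
    (φ : ∀ X, F.obj X → β) (hφ : ∀ X, Function.Injective (φ X))
    (hF : ∀ {X Y : I} (f : X ⟶ Y) (a : F.obj X), φ Y (F.map f a) = φ X a) :
    TrivialMonodromy F := by
  intro X a b h
  refine hφ X (rel_of_zigzag (r := fun p q : F.Elements => φ p.1 p.2 = φ q.1 q.2)
    ⟨fun _ => rfl, Eq.symm, Eq.trans⟩ (fun {p q} f => ?_) h)
  rw [← f.2, hF]

end Monodromy

/-! ### Partial injections and pseudoinverses -/

/-- The objects of the category of types and partial injections. -/
structure PInj : Type (t + 1) where
  carrier : Type t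

instance PInj.category : Category.{t} PInj.{t} where
  Hom X Y := X.carrier ≃. Y.carrier
  id X := PEquiv.refl X.carrier
  comp f g := f.trans g
  id_comp := PEquiv.refl_trans
  comp_id := PEquiv.trans_refl
  assoc := PEquiv.trans_assoc

theorem IsPseudoinverse.symm {C : Type u} [Category.{v} C] {X Y : C} {f : X ⟶ Y} {g : Y ⟶ X}
    (h : IsPseudoinverse f g) : IsPseudoinverse g f :=
  ⟨h.2, h.1⟩

theorem IsPseudoinverse.map {C : Type u} [Category.{v} C] {D : Type w} [Category.{w'} D] {X Y : C}
    {f : X ⟶ Y} {g : Y ⟶ X} (h : IsPseudoinverse f g) (F : C ⥤ D) :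
    IsPseudoinverse (F.map f) (F.map g) := by
  simp only [IsPseudoinverse, ← F.map_comp, h.1, h.2, and_self]

namespace PInj

variable {X Y Z : PInj.{t}}

theorem mem_comp (f : X ⟶ Y) (g : Y ⟶ Z) {a : X.carrier} {c : Z.carrier} :
    c ∈ (f ≫ g).toFun a ↔ ∃ b, b ∈ f.toFun a ∧ c ∈ g.toFun b :=
  PEquiv.mem_trans f g a c

theorem mem_of_isPseudoinverse {f : X ⟶ Y} {g : Y ⟶ X} (h : IsPseudoinverse f g)
    {a : X.carrier} {b : Y.carrier} (hb : b ∈ f.toFun a) : a ∈ g.toFun b := by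
  obtain ⟨b', hb', hg⟩ := (mem_comp f _).1 (h.1.symm ▸ hb)
  obtain ⟨a', ha', hf⟩ := (mem_comp g f).1 hg
  obtain rfl : a = a' := PEquiv.inj f hb hf
  obtain rfl : b = b' := Option.mem_unique hb hb'
  exact ha'

theorem isPseudoinverse_iff (f : X ⟶ Y) (g : Y ⟶ X) :
    IsPseudoinverse f g ↔ g = PEquiv.symm f := by
  have symm_le : ∀ {X Y : PInj.{t}} {f : X ⟶ Y} {g : Y ⟶ X}, IsPseudoinverse f g →
      PEquiv.symm f ≤ g := fun h b a ha => mem_of_isPseudoinverse h ((PEquiv.mem_iff_mem _).1 ha)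
  have comp_symm : ∀ {X Y : PInj.{t}} (f : X ⟶ Y),
      f ≫ (show Y ⟶ X from PEquiv.symm f) ≫ f = f := fun {X Y} f => by
    refine le_antisymm (α := X.carrier ≃. Y.carrier) (fun a c hc => ?_) fun a b hb =>
      (mem_comp _ _).2 ⟨b, hb, (mem_comp _ _).2 ⟨a, (PEquiv.mem_iff_mem _).2 hb, hb⟩⟩
    obtain ⟨b, hb, hc⟩ := (mem_comp _ _).1 hc
    obtain ⟨a', ha', hc⟩ := (mem_comp _ _).1 hc
    obtain rfl : a = a' := PEquiv.inj f hb ((PEquiv.mem_iff_mem f).1 ha')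
    exact hc
  constructor
  · intro h
    exact le_antisymm (α := Y.carrier ≃. X.carrier)
      (fun b a ha => (PEquiv.mem_iff_mem f).2 (symm_le h.symm a b ((PEquiv.mem_iff_mem g).2 ha)))
      (symm_le h)
  · rintro rfl
    exact ⟨comp_symm f, comp_symm (X := Y) (Y := X) (PEquiv.symm f)⟩

theorem isInverseCategory : IsInverseCategory PInj.{t} := fun _ _ f =>
  ⟨PEquiv.symm f, (isPseudoinverse_iff f _).2 rfl, fun g hg => (isPseudoinverse_iff f g).1 hg⟩

theorem eq_of_mem_of_comp_self {f : X ⟶ X} (hf : f ≫ f = f) {a b : X.carrier}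
    (h : b ∈ f.toFun a) : a = b := by
  obtain ⟨c, hc, hb⟩ := (mem_comp f f).1 (hf.symm ▸ h)
  obtain rfl : b = c := Option.mem_unique h hc
  exact PEquiv.inj f h hb

/-- The functor to partial injections underlying a functor to injections. -/
noncomputable def ofInjective {I : Type w} [Category.{w'} I] (F : I ⥤ Type t)
    (hF : ∀ ⦃X Y : I⦄ (f : X ⟶ Y), Function.Injective (F.map f)) : I ⥤ PInj.{t} where
  obj X := ⟨F.obj X⟩
  map f := ⟨fun a => some (F.map f a), Function.partialInv (F.map f),
    fun a b => ((hF f).isPartialInv a b).trans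
      (Option.mem_some_iff.trans Iff.rfl).symm⟩
  map_id X := PEquiv.ext fun a => congrArg some (ConcreteCategory.congr_hom (F.map_id X) a)
  map_comp f g := PEquiv.ext fun a => congrArg some (ConcreteCategory.congr_hom (F.map_comp f g) a)

theorem comp_ofInjective_pseudoinverse {I : Type w} [Category.{w'} I] {F : I ⥤ Type t}
    (hF : ∀ ⦃X Y : I⦄ (f : X ⟶ Y), Function.Injective (F.map f)) {X Y : I} (f : X ⟶ Y)
    (g : (ofInjective F hF).obj Y ⟶ (ofInjective F hF).obj X)
    (hg : IsPseudoinverse ((ofInjective F hF).map f) g) : (ofInjective F hF).map f ≫ g = 𝟙 _ := by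
  obtain rfl := (isPseudoinverse_iff _ g).1 hg
  exact PEquiv.trans_symm_eq_iff_forall_isSome.2 fun a => rfl

end PInj

section FundamentalInverseCategory

variable {I : Type w} [Category.{w'} I]

theorem UpwardSimplyConnected.eq_of_eqvGen (h : UpwardSimplyConnected I) {H : I ⥤ PInj.{t}}
    (hH : ∀ {X Y : I} (f : X ⟶ Y) (g : H.obj Y ⟶ H.obj X),
      IsPseudoinverse (H.map f) g → H.map f ≫ g = 𝟙 _) {X : I} {a b : (H.obj X).carrier}
    (hab : Relation.EqvGen (fun p q : Σ X, (H.obj X).carrier =>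
      ∃ f : p.1 ⟶ q.1, q.2 ∈ (H.map f).toFun p.2) ⟨X, a⟩ ⟨X, b⟩) : a = b := by
  obtain ⟨G, rfl, -⟩ := LeftFundInv.existsUnique_lift I PInj PInj.isInverseCategory H hH
  have exists_mem : ∀ {p q : Σ X, (G.obj ((LeftFundInv.η I).obj X)).carrier},
      Relation.EqvGen (fun p q => ∃ f : p.1 ⟶ q.1,
        q.2 ∈ (G.map ((LeftFundInv.η I).map f)).toFun p.2) p q →
      ∃ f : (LeftFundInv.η I).obj p.1 ⟶ (LeftFundInv.η I).obj q.1,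
        q.2 ∈ (G.map f).toFun p.2 := fun hpq => by
    induction hpq with
    | rel _ _ hf => exact ⟨_, hf.choose_spec⟩
    | refl p => exact ⟨𝟙 _, by rw [G.map_id]; exact Option.mem_some_self _⟩
    | symm _ _ _ ih =>
      obtain ⟨f, hf⟩ := ih
      obtain ⟨g, hg, -⟩ := LeftFundInv.isInverseCategory I f
      exact ⟨g, PInj.mem_of_isPseudoinverse (hg.map G) hf⟩
    | trans _ _ _ _ _ ih ih' =>
      obtain ⟨f, hf⟩ := ih
      obtain ⟨g, hg⟩ := ih'
      exact ⟨f ≫ g, by rw [G.map_comp]; exact (PInj.mem_comp _ _).2 ⟨_, hf, hg⟩⟩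
  obtain ⟨f, hf⟩ := exists_mem hab
  exact PInj.eq_of_mem_of_comp_self (by rw [← G.map_comp, h _ f]) hf

theorem UpwardSimplyConnected.trivialMonodromy (h : UpwardSimplyConnected I) {F : I ⥤ Type t}
    (hF : ∀ ⦃X Y : I⦄ (f : X ⟶ Y), Function.Injective (F.map f)) : TrivialMonodromy F := by
  intro X a b hab
  let r (p q : F.Elements) : Prop :=
    ∃ f : p.1 ⟶ q.1, q.2 ∈ ((PInj.ofInjective F hF).map f).toFun p.2
  refine h.eq_of_eqvGen (PInj.comp_ofInjective_pseudoinverse hF) ?_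
  exact rel_of_zigzag (I := F.Elements) (r := Relation.EqvGen r) (Relation.EqvGen.is_equivalence r)
    (fun {p q} (f : p ⟶ q) => .rel _ _ ⟨f.1, congrArg some f.2⟩) hab

theorem IsInverseCategory.comp_pseudoinverse_eq {C : Type u} [Category.{v} C]
    (hC : IsInverseCategory C) {X Y Z : C} {p : X ⟶ Y} {f : Y ⟶ Z} {u : Z ⟶ Y}
    (h : p ≫ f ≫ u = p) {g : Z ⟶ Y} (hg : IsPseudoinverse f g) : p ≫ f ≫ g = p := by
  obtain ⟨q, ⟨hpq, -⟩, -⟩ := hC p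
  have hcomm : (q ≫ p) ≫ f ≫ g = (f ≫ g) ≫ q ≫ p :=
    hC.idem_comm _ _ (by rw [Category.assoc, hpq]) (by rw [Category.assoc, hg.2])
  have hqp' : (q ≫ p) ≫ f ≫ g = q ≫ p := by
    calc (q ≫ p) ≫ f ≫ g = (f ≫ g) ≫ q ≫ p ≫ f ≫ u := by rw [hcomm, h]
      _ = ((f ≫ g) ≫ q ≫ p) ≫ f ≫ u := by simp only [Category.assoc]
      _ = q ≫ p ≫ (f ≫ g ≫ f) ≫ u := by rw [← hcomm]; simp only [Category.assoc]
      _ = q ≫ p := by rw [hg.1, h]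
  calc p ≫ f ≫ g = p ≫ (q ≫ p) ≫ f ≫ g := by
        rw [← Category.assoc p (q ≫ p), hpq]
    _ = p := by rw [hqp', hpq]

theorem LeftFundInv.hom_induction {W : MorphismProperty (LeftFundInv I)}
    (map : ∀ {X Y : I} (i : X ⟶ Y), W ((LeftFundInv.η I).map i))
    (comp : ∀ {X Y Z} (f : X ⟶ Y) (g : Y ⟶ Z), W f → W g → W (f ≫ g))
    (inv : ∀ {X Y} (f : X ⟶ Y) (g : Y ⟶ X), IsPseudoinverse f g → W f → W g)
    {X Y : LeftFundInv I} (f : X ⟶ Y) : W f := by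
  obtain ⟨X⟩ := X
  obtain ⟨Y⟩ := Y
  let mk {X Y : I} (s : InvTerm I X Y) : (⟨X⟩ : LeftFundInv I) ⟶ ⟨Y⟩ :=
    Quotient.mk (InvTerm.setoid X Y) s
  obtain ⟨s, rfl⟩ : ∃ s, mk s = f := Quotient.exists_rep f
  induction s with
  | of i => exact map i
  | id X =>
    have h := map (𝟙 X)
    rwa [(LeftFundInv.η I).map_id] at h
  | comp s s' ih ih' => exact comp (mk s) (mk s') ih ih'
  | inv s ih =>
    refine inv (mk s) (mk s.inv) ⟨Quotient.sound (.regular s), Quotient.sound ?_⟩ ih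
    exact .trans (.comp_congr (.refl _) (.comp_congr (.symm (.inv_inv s)) (.refl _)))
      (.regular s.inv)

/-- The functor `X ↦ Hom(A, η X)` represented by an object `A` of the left fundamental inverse
category, along which the morphisms of that category transport. -/
abbrev LeftFundInv.homFrom (A : LeftFundInv I) : I ⥤ Type max w w' :=
  LeftFundInv.η I ⋙ coyoneda.obj (Opposite.op A)

/-- A morphism out of `A` as an element of the functor represented by `A`. -/
abbrev LeftFundInv.toElements {A X : LeftFundInv I} (p : A ⟶ X) : A.homFrom.Elements :=
  ⟨X.as, p⟩

theorem LeftFundInv.zigzag_comp {X Y A : LeftFundInv I} (f : X ⟶ Y) (p : A ⟶ X) {u : Y ⟶ X}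
    (h : p ≫ f ≫ u = p) : Zigzag (toElements p) (toElements (p ≫ f)) := by
  refine hom_induction (W := fun X Y f => ∀ (p : A ⟶ X) (u : Y ⟶ X), p ≫ f ≫ u = p →
    Zigzag (toElements p) (toElements (p ≫ f))) ?_ ?_ ?_ f p u h
  · intro X Y i p _ _
    exact .of_hom (CategoryOfElements.homMk _ _ i rfl)
  · intro X Y Z f g ih ih' p u h
    rw [Category.assoc] at h
    have h' : (p ≫ f) ≫ g ≫ u ≫ f = p ≫ f := by
      conv_rhs => rw [← h]
      simp only [Category.assoc]
    rw [← Category.assoc]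
    exact (ih p _ h).trans (ih' (p ≫ f) _ h')
  · intro X Y f g hfg ih p u h
    have hpgf := (LeftFundInv.isInverseCategory I).comp_pseudoinverse_eq h hfg.symm
    have hzig := ih (p ≫ g) g (by rw [Category.assoc, hfg.2])
    rw [Category.assoc, hpgf] at hzig
    exact hzig.symm

theorem LeftFundInv.homFrom_map_injective (A : LeftFundInv I) ⦃X Y : I⦄ (f : X ⟶ Y) :
    Function.Injective (A.homFrom.map f) := by
  intro p q (hpq : p ≫ (LeftFundInv.η I).map f = q ≫ (LeftFundInv.η I).map f)
  obtain ⟨g, hg, -⟩ := LeftFundInv.isInverseCategory I ((LeftFundInv.η I).map f)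
  simpa only [Category.assoc, LeftFundInv.η_mono I f g hg, Category.comp_id] using hpq =≫ g

theorem UpwardSimplyConnected.of_trivialMonodromy
    (h : ∀ A : LeftFundInv I, TrivialMonodromy A.homFrom) : UpwardSimplyConnected I := by
  intro A f
  obtain ⟨g, hg, -⟩ := LeftFundInv.isInverseCategory I f
  have hfg : f = f ≫ g := h A _ _ (LeftFundInv.zigzag_comp g f hg.1)
  calc f ≫ f = f ≫ g ≫ f := by rw [← Category.assoc, ← hfg]
    _ = f := hg.1

end FundamentalInverseCategory

/-! ### Diagrams of injections -/

theorem exists_embedding_sum_trans_eq {α : Type*} {β γ : Type*} (f : α ↪ β) (g : α ↪ γ) :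
    ∃ (h : β ↪ β ⊕ γ) (k : γ ↪ β ⊕ γ), f.trans h = g.trans k := by
  let k : γ → β ⊕ γ := Function.extend g (Sum.inl ∘ f) Sum.inr
  have hkg (a : α) : k (g a) = Sum.inl (f a) := g.injective.extend_apply _ _ a
  have hk (z : γ) (hz : ¬ ∃ a, g a = z) : k z = Sum.inr z := Function.extend_apply' _ _ z hz
  refine ⟨.inl, ⟨k, fun y z hyz => ?_⟩, Function.Embedding.ext fun a => (hkg a).symm⟩
  by_cases hy : ∃ a, g a = y <;> by_cases hz : ∃ a, g a = z
  · obtain ⟨a, rfl⟩ := hy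
    obtain ⟨b, rfl⟩ := hz
    rw [hkg, hkg] at hyz
    rw [f.injective (Sum.inl_injective hyz)]
  · obtain ⟨a, rfl⟩ := hy
    simp [hkg, hk z hz] at hyz
  · obtain ⟨b, rfl⟩ := hz
    simp [hkg, hk y hy] at hyz
  · rw [hk y hy, hk z hz] at hyz
    exact Sum.inr_injective hyz

/-- The subsets of `α`, to be made into a category with all injections between them as morphisms. -/
structure SubsetEmb (α : Type t) : Type t where
  carrier : Set α

namespace SubsetEmb

variable {α : Type t}

instance category : Category.{t} (SubsetEmb α) where
  Hom S T := S.carrier ↪ T.carrier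
  id S := .refl S.carrier
  comp f g := f.trans g

theorem hasAP [Infinite α] : HasAP (SubsetEmb α) := by
  refine hasAP_of_exists fun {X Y Z} f g => ?_
  obtain ⟨e⟩ : Nonempty (α ⊕ α ≃ α) := Cardinal.eq.1 <| by
    rw [Cardinal.mk_sum, Cardinal.lift_id, Cardinal.add_eq_self (Cardinal.aleph0_le_mk α)]
  let i : Y.carrier ⊕ Z.carrier ↪ (Set.univ : Set α) :=
    ((Function.Embedding.sumMap (.subtype _) (.subtype _)).trans e.toEmbedding).trans
      (Equiv.Set.univ α).symm.toEmbedding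
  obtain ⟨h, k, hhk⟩ := exists_embedding_sum_trans_eq f g
  exact ⟨⟨Set.univ⟩, h.trans i, k.trans i, congrArg (fun l => l.trans i) hhk⟩

theorem hasJEP : HasJEP (SubsetEmb α) := hasJEP_of_exists fun _ X =>
  ⟨⟨Set.univ⟩, fun k => ⟨Set.embeddingOfSubset _ _ (Set.subset_univ (X k).carrier)⟩⟩

variable {I : Type w} [Category.{w'} I] (F : I ⥤ Type v)
  (hF : ∀ ⦃X Y : I⦄ (f : X ⟶ Y), Function.Injective (F.map f)) (e : ∀ X, F.obj X ↪ α)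

/-- The diagram of subsets of `α` given by a diagram of injections whose values embed in `α`. -/
noncomputable def ofInjective : I ⥤ SubsetEmb α where
  obj X := ⟨Set.range (e X)⟩
  map {X Y} f := ((Equiv.ofInjective (e X) (e X).injective).symm.toEmbedding.trans
    ⟨F.map f, hF f⟩).trans (Equiv.ofInjective (e Y) (e Y).injective).toEmbedding
  map_id X := Function.Embedding.ext fun x => by
    obtain ⟨a, rfl⟩ := (Equiv.ofInjective (e X) (e X).injective).surjective x
    change Equiv.ofInjective (e X) (e X).injective (F.map (𝟙 X) _) = _
    rw [Functor.map_id_apply]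
    exact congrArg _ (Equiv.symm_apply_apply _ _)
  map_comp {X Y Z} f g := Function.Embedding.ext fun x => by
    change _ = Equiv.ofInjective (e Z) (e Z).injective (F.map g _)
    simp

theorem ofInjective_map {X Y : I} (f : X ⟶ Y) :
    (Equiv.ofInjective (e X) (e X).injective).toEmbedding.trans ((ofInjective F hF e).map f) =
      .trans ⟨F.map f, hF f⟩ (Equiv.ofInjective (e Y) (e Y).injective).toEmbedding :=
  Function.Embedding.ext fun a => congrArg (Equiv.ofInjective (e Y) (e Y).injective ∘ F.map f)
    (Equiv.symm_apply_apply _ a)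

end SubsetEmb

theorem CoconesFromAPJEP.trivialMonodromy {I : Type w} [Category.{w'} I] {α : Type t} [Infinite α]
    (h : CoconesFromAPJEP.{w, w', t, t} I) {F : I ⥤ Type v}
    (hF : ∀ ⦃X Y : I⦄ (f : X ⟶ Y), Function.Injective (F.map f)) (e : ∀ X, F.obj X ↪ α) :
    TrivialMonodromy F := by
  obtain ⟨c⟩ := h (SubsetEmb α) SubsetEmb.hasAP SubsetEmb.hasJEP (SubsetEmb.ofInjective F hF e)
  let φ X : F.obj X ↪ c.pt.carrier :=
    (Equiv.ofInjective (e X) (e X).injective).toEmbedding.trans (c.ι.app X)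
  have hφ {X Y : I} (f : X ⟶ Y) : .trans ⟨F.map f, hF f⟩ (φ Y) = φ X :=
    (congrArg (·.trans (c.ι.app Y)) (SubsetEmb.ofInjective_map F hF e f)).symm.trans
      (congrArg (Function.Embedding.trans _) (c.w f))
  exact .of_injective_cocone (fun X => φ X) (fun X => (φ X).injective) fun f a =>
    DFunLike.congr_fun (hφ f) a

/-! ### Independence of the universe levels -/

section ULift

variable {C : Type u} [Category.{v} C]

attribute [local instance] uliftCategory

theorem HasAP.ulift (hC : HasAP C) : HasAP (ULiftHom.{w'} (ULift.{w} C)) := by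
  refine hasAP_of_exists fun {X Y Z} f g => ?_
  obtain ⟨W, h, k, e⟩ := hC.exists_comp_eq (X := X.objDown.down) f.down g.down
  exact ⟨ULiftHom.objUp ⟨W⟩, ⟨h⟩, ⟨k⟩, congrArg ULift.up e⟩

theorem HasJEP.ulift (hC : HasJEP C) : HasJEP (ULiftHom.{w'} (ULift.{w} C)) := by
  refine hasJEP_of_exists fun n X => ?_
  obtain ⟨W, hW⟩ := hC.exists_hom fun k => (X k).objDown.down
  exact ⟨ULiftHom.objUp ⟨W⟩, fun k => ⟨⟨(hW k).some⟩⟩⟩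

theorem nonempty_cocone_of_ulift {I : Type*} [Category I] (F : I ⥤ C)
    (h : Nonempty (Cocone ((F ⋙ ULift.upFunctor.{v, u, w}) ⋙
      (ULiftHom.up : ULift.{w} C ⥤ ULiftHom.{w'} (ULift.{w} C))))) :
    Nonempty (Cocone F) :=
  h.map fun c => ⟨c.pt.objDown.down, fun X => (c.ι.app X).down,
    fun _ _ f => congrArg ULift.down (c.ι.naturality f)⟩

theorem CoconesFromAPJEP.down {I : Type w} [Category.{w'} I]
    (h : CoconesFromAPJEP.{w, w', u, v} I) : CoconesFromAPJEP.{w, w', 0, 0} I :=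
  fun C _ hC hC' F => nonempty_cocone_of_ulift F
    (h (ULiftHom.{v} (ULift.{u} C)) hC.ulift hC'.ulift _)

theorem CoconesFromAP.down {I : Type w} [Category.{w'} I]
    (h : CoconesFromAP.{w, w', u, v} I) : CoconesFromAP.{w, w', 0, 0} I :=
  fun C _ hC F => nonempty_cocone_of_ulift F (h (ULiftHom.{v} (ULift.{u} C)) hC.ulift _)

end ULift

/-! ### Consequences of trivial monodromy -/

section NoMonodromy

variable {I : Type w} [Category.{w'} I]

theorem NoMonodromy.isThin [∀ X Y : I, Countable (X ⟶ Y)] (h : NoMonodromy I) :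
    Quiver.IsThin (MonicReflection I) := by
  refine MonicReflection.isThin_iff.2 fun X Y f g => ?_
  let q := toMonicReflection I
  let F : I ⥤ Type w' := q ⋙ coyoneda.obj (Opposite.op (q.obj X))
  have hF ⦃X Y : I⦄ (f : X ⟶ Y) : Function.Injective (F.map f) := fun a b hab =>
    (cancel_mono (q.map f)).1 hab
  have hzig : Zigzag (F.elementsMk Y (q.map f)) (F.elementsMk Y (q.map g)) :=
    have hom (k : X ⟶ Y) : F.elementsMk X (𝟙 (q.obj X)) ⟶ F.elementsMk Y (q.map k) :=
      CategoryOfElements.homMk _ _ k (Category.id_comp (q.map k))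
    (Zigzag.of_inv (hom f)).trans (.of_hom (hom g))
  exact (CategoryTheory.Quotient.functor_map_eq_iff (monicRel I) f g).1
    (h F hF (fun Y => (q.map_surjective (X := X) (Y := Y)).countable) _ _ hzig)

open Classical in
/-- The exchange of the two sheets of `doubleCover` along a morphism from `X` to `Y`. -/
noncomputable def sheetSwap (p : I) (S : Set I) (X Y : I) : Bool :=
  decide (Nonempty (X ⟶ p) ∧ ¬ Nonempty (Y ⟶ p) ∧ Y ∈ S)

theorem sheetSwap_eq_xor {p : I} {S : Set I} (hS : ClopenOn (fun X Y : I => Nonempty (X ⟶ Y))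
    {z | Nonempty (p ⟶ z) ∧ ¬ Nonempty (z ⟶ p)} S) {X Y Z : I} (f : X ⟶ Y) (g : Y ⟶ Z)
    (hX : Nonempty (X ⟶ p) → Nonempty (p ⟶ X)) :
    sheetSwap p S X Z = xor (sheetSwap p S X Y) (sheetSwap p S Y Z) := by
  unfold sheetSwap
  by_cases hXp : Nonempty (X ⟶ p)
  · obtain ⟨k⟩ := hX hXp
    by_cases hYp : Nonempty (Y ⟶ p)
    · simp [hXp, hYp]
    · have hZp : ¬ Nonempty (Z ⟶ p) := fun ⟨l⟩ => hYp ⟨g ≫ l⟩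
      have hYZ := hS Y ⟨⟨k ≫ f⟩, hYp⟩ Z ⟨⟨k ≫ f ≫ g⟩, hZp⟩ ⟨g⟩
      simp [hXp, hYp, hZp, hYZ]
  · have hYp : ¬ Nonempty (Y ⟶ p) := fun ⟨l⟩ => hXp ⟨f ≫ l⟩
    simp [hXp, hYp]

/-- The double cover of the upward-closed part of `I` formed by the objects that are not strictly
below `p`, obtained by gluing two sheets over the objects not below `p` to two sheets over the
objects equivalent to `p`, with the sheets exchanged over `S`. -/
noncomputable def doubleCover (p : I) {S : Set I}
    (hS : ClopenOn (fun X Y : I => Nonempty (X ⟶ Y))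
      {z | Nonempty (p ⟶ z) ∧ ¬ Nonempty (z ⟶ p)} S) : I ⥤ Type t where
  obj X := ULift {_b : Bool // Nonempty (X ⟶ p) → Nonempty (p ⟶ X)}
  map {X Y} f := TypeCat.ofHom fun b =>
    ⟨xor b.down.1 (sheetSwap p S X Y), fun ⟨k⟩ => ⟨(b.down.2 ⟨f ≫ k⟩).some ≫ f⟩⟩
  map_id X := by
    have hXX : sheetSwap p S X X = false := by simp +contextual [sheetSwap]
    ext ⟨b, hb⟩
    simp [hXX]
  map_comp {X Y Z} f g := by
    ext ⟨b, hb⟩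
    simp [sheetSwap_eq_xor hS f g hb]

theorem doubleCover_map_injective {p : I} {S : Set I}
    (hS : ClopenOn (fun X Y : I => Nonempty (X ⟶ Y))
      {z | Nonempty (p ⟶ z) ∧ ¬ Nonempty (z ⟶ p)} S) ⦃X Y : I⦄ (f : X ⟶ Y) :
    Function.Injective ((doubleCover.{w, w', t} p hS).map f) := by
  intro a b hab
  have hab' := congrArg (fun c => c.down.1) hab
  exact ULift.ext _ _ (Subtype.ext (Bool.xor_left_inj.1 hab'))

theorem NoMonodromy.extendsClopens (h : NoMonodromy I) :
    ExtendsClopens fun X Y : I => Nonempty (X ⟶ Y) := by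
  classical
  intro p S hS
  let F : I ⥤ Type w' := doubleCover p hS
  have hF : TrivialMonodromy F := h F (doubleCover_map_injective hS) fun X =>
    inferInstanceAs (Countable (ULift _))
  let pt (X : I) (hX : Nonempty (X ⟶ p) → Nonempty (p ⟶ X)) (b : Bool) : F.Elements :=
    F.elementsMk X ⟨b, hX⟩
  have zigzag {X Y : I} (f : X ⟶ Y) hX hY b :
      Zigzag (pt X hX b) (pt Y hY (xor b (sheetSwap p S X Y))) :=
    .of_hom (CategoryOfElements.homMk _ _ f rfl)
  let T : Set I := {z | ∃ hz, Zigzag (pt p id false) (pt z hz true)}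
  refine ⟨T, fun X hX Y hY ⟨f⟩ => ?_, fun z ⟨f⟩ hz => ?_⟩
  · have hXY := zigzag f (fun h => (hX h).elim) (fun h => (hY h).elim) true
    rw [show sheetSwap p S X Y = false from decide_eq_false fun h => hX h.1] at hXY
    exact ⟨fun ⟨_, h⟩ => ⟨_, h.trans hXY⟩, fun ⟨_, h⟩ => ⟨_, h.trans hXY.symm⟩⟩
  · have hpz := zigzag f id (fun h => (hz h).elim) false
    rw [Bool.false_xor, show sheetSwap p S p z = decide (z ∈ S) from
      decide_eq_decide.2 ⟨fun h => h.2.2, fun h => ⟨⟨𝟙 p⟩, hz, h⟩⟩] at hpz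
    refine ⟨fun ⟨_, h⟩ => ?_, fun h => ⟨fun h => (hz h).elim, ?_⟩⟩
    · exact of_decide_eq_true (congrArg (fun b => b.down.1) (hF _ _ (hpz.symm.trans h)))
    · rwa [decide_eq_true h] at hpz

end NoMonodromy

/-! ### Characterizations of upward simple connectedness -/

section Characterizations

variable {I : Type w} [Category.{w'} I]

theorem UpwardSimplyConnected.of_coconesFromAPJEP
    (h : CoconesFromAPJEP.{w, w', max w w', max w w'} I) : UpwardSimplyConnected I :=
  .of_trivialMonodromy fun A =>
    h.trivialMonodromy (α := ℕ ⊕ Σ X : I, A.homFrom.obj X) A.homFrom_map_injective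
      fun X => (Function.Embedding.sigmaMk X).trans .inr

theorem CoconesFromAPJEP.noMonodromy (h : CoconesFromAPJEP.{w, w', u, v} I) : NoMonodromy I :=
  fun _ hF _ => h.down.trivialMonodromy hF fun _ => (nonempty_embedding_nat _).some

theorem toMonicSkeleton_extendsClopens (h : ExtendsClopens fun X Y : I => Nonempty (X ⟶ Y)) :
    ExtendsClopens ((· ≤ ·) : ThinSkeleton (MonicReflection I) → _ → Prop) :=
  h.of_surjective toMonicSkeleton_surjective toMonicSkeleton_le_iff

theorem hasAP_discrete (α : Type u) : HasAP (Discrete α) :=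
  hasAP_of_exists fun {X _ _} f g =>
    ⟨X, eqToHom (Discrete.ext (Discrete.eq_of_hom f).symm),
      eqToHom (Discrete.ext (Discrete.eq_of_hom g).symm), Subsingleton.elim _ _⟩

theorem CoconesFromAP.isConnected (h : CoconesFromAP.{w, w', u, v} I) :
    CategoryTheory.IsConnected I := by
  have : Nonempty I := by
    by_contra! hI
    obtain ⟨c⟩ := h.down (Discrete PEmpty) (hasAP_discrete _) (functorOfIsEmpty I _)
    exact c.pt.as.elim
  refine IsConnected.of_induct (j₀ := Classical.arbitrary I) fun p hp₀ hp X => ?_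
  obtain ⟨c⟩ := h.down (Discrete Prop) (hasAP_discrete _)
    { obj := fun X => ⟨X ∈ p⟩
      map := fun f => eqToHom (Discrete.ext (propext (hp f))) }
  have hpt (X : I) : (X ∈ p) = c.pt.as := Discrete.eq_of_hom (c.ι.app X)
  rwa [hpt, ← hpt (Classical.arbitrary I)]

variable [Finite (Σ X Y : I, X ⟶ Y)]

theorem finite_monicSkeleton : Finite (ThinSkeleton (MonicReflection I)) :=
  have : Finite I := .of_injective (fun X => (⟨X, X, 𝟙 X⟩ : Σ X Y : I, X ⟶ Y))
    fun _ _ h => congrArg Sigma.fst h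
  .of_surjective _ toMonicSkeleton_surjective

theorem UpwardSimplyConnected.tfae : List.TFAE [
    UpwardSimplyConnected I,
    CoconesFromAPJEP.{w, w', u, v} I,
    ∃ _ : Quiver.IsThin (MonicReflection I), ForestLike (ThinSkeleton (MonicReflection I)),
    NoMonodromy I,
    Quiver.IsThin (MonicReflection I) ∧ ExtendsClopens fun X Y : I => Nonempty (X ⟶ Y)] := by
  have (X Y : I) : Finite (X ⟶ Y) := .of_injective (fun f => (⟨X, Y, f⟩ : Σ X Y : I, X ⟶ Y))
    fun _ _ h => by simpa using h
  have := finite_monicSkeleton (I := I)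
  tfae_have 1 → 4 := fun h _ hF _ => h.trivialMonodromy hF
  tfae_have 2 → 4 := fun h => h.noMonodromy
  tfae_have 4 → 5 := fun h => ⟨h.isThin, h.extendsClopens⟩
  tfae_have 5 → 3 := fun ⟨ht, h⟩ => ⟨ht, .of_extendsClopens (toMonicSkeleton_extendsClopens h)⟩
  tfae_have 3 → 2 := fun ⟨_, h⟩ => .of_forestLike h
  tfae_have 3 → 1 := fun ⟨_, h⟩ => .of_coconesFromAPJEP (.of_forestLike h)
  tfae_finish

theorem coconesFromAP_iff : CoconesFromAP.{w, w', u, v} I ↔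
    UpwardSimplyConnected I ∧ CategoryTheory.IsConnected I := by
  have := finite_monicSkeleton (I := I)
  constructor
  · intro h
    have h' : CoconesFromAPJEP.{w, w', u, v} I := fun C _ hC _ F => h C hC F
    exact ⟨(UpwardSimplyConnected.tfae.out 0 1).2 h', h.isConnected⟩
  · rintro ⟨h, hI⟩
    obtain ⟨ht, hext⟩ := (UpwardSimplyConnected.tfae.{w, w', u, v}.out 0 4).1 h
    have := isConnected_of_functor_surjective _ (toMonicSkeleton_surjective (I := I))
    exact .of_treeLike (.of_extendsClopens _ (toMonicSkeleton_extendsClopens hext))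

end Characterizations

/-! ### Base digits as tables of finite functions -/

/-- The `i`-th digit of `x` in base `b`, starting from the units. In this way `x` encodes a function
to `{0, …, b - 1}`, and a set when `b = 2`. -/
def baseDigit (b x i : ℕ) : ℕ := x / b ^ i % b

theorem exists_baseDigit_eq {b n : ℕ} (f : Fin n → Fin b) :
    ∃ x < b ^ n, ∀ i : Fin n, baseDigit b x i = f i := by
  refine ⟨finFunctionFinEquiv f, Fin.is_lt _, fun i => ?_⟩
  have := congrFun (finFunctionFinEquiv.symm_apply_apply f) i
  exact (congrArg Fin.val this :)

/-- The kernel of the function encoded by `x` in base `b`. -/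
def SameDigit (b x i j : ℕ) : Prop := baseDigit b x i = baseDigit b x j

theorem exists_sameDigit_iff {n : ℕ} (r : Setoid (Fin n)) :
    ∃ x < n ^ n, ∀ i j : Fin n, SameDigit n x i j ↔ r i j := by
  obtain ⟨x, hx, h⟩ := exists_baseDigit_eq fun i => (⟦i⟧ : _root_.Quotient r).out
  refine ⟨x, hx, fun i j => ?_⟩
  rw [SameDigit, h, h, Fin.val_inj, Quotient.out_inj, Quotient.eq]

theorem exists_baseDigit_two_eq_one_iff {n : ℕ} (S : Set (Fin n)) :
    ∃ x < 2 ^ n, ∀ i : Fin n, baseDigit 2 x i = 1 ↔ i ∈ S := by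
  classical
  obtain ⟨x, hx, h⟩ := exists_baseDigit_eq fun i => if i ∈ S then (1 : Fin 2) else 0
  refine ⟨x, hx, fun i => ?_⟩
  rw [h]
  split_ifs with hi <;> simp [hi]

theorem baseDigit_two_eq_iff (x y i j : ℕ) : baseDigit 2 x i = baseDigit 2 y j ↔
    (baseDigit 2 x i = 1 ↔ baseDigit 2 y j = 1) := by
  unfold baseDigit
  omega

section PrimrecPred

variable {α : Type*} [Primcodable α]

theorem primrecPred_imp {p q : α → Prop} (hp : PrimrecPred p) (hq : PrimrecPred q) :
    PrimrecPred fun a => p a → q a :=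
  (hp.not.or hq).of_eq fun _ => imp_iff_not_or.symm

theorem primrecPred_forall_lt {b : α → ℕ} {p : α → ℕ → Prop} (hb : Primrec b)
    (hp : PrimrecPred fun q : α × ℕ => p q.1 q.2) : PrimrecPred fun a => ∀ x < b a, p a x := by
  have hR : PrimrecRel fun (x : ℕ) (a : α) => p a x := hp.comp (.pair .snd .fst)
  exact (hR.forall_mem_list.comp (Primrec.list_range.comp hb) .id).of_eq fun a => by
    simp only [List.mem_range, id]

theorem primrecPred_exists_lt {b : α → ℕ} {p : α → ℕ → Prop} (hb : Primrec b)
    (hp : PrimrecPred fun q : α × ℕ => p q.1 q.2) : PrimrecPred fun a => ∃ x < b a, p a x :=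
  (primrecPred_forall_lt (p := fun a x => ¬ p a x) hb hp.not).not.of_eq fun a => by push Not; rfl

theorem primrec_pow {b n : α → ℕ} (hb : Primrec b) (hn : Primrec n) :
    Primrec fun a => b a ^ n a :=
  (Primrec₂.unpaired'.1 Nat.Primrec.pow).comp hb hn

theorem primrecPred_eq {f g : α → ℕ} (hf : Primrec f) (hg : Primrec g) :
    PrimrecPred fun a => f a = g a := Primrec.eq.comp hf hg

theorem primrec_baseDigit {b x i : α → ℕ} (hb : Primrec b) (hx : Primrec x) (hi : Primrec i) :
    Primrec fun a => baseDigit (b a) (x a) (i a) :=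
  Primrec.nat_mod.comp (Primrec.nat_div.comp hx (primrec_pow hb hi)) hb

theorem primrecPred_sameDigit {b x i j : α → ℕ} (hb : Primrec b) (hx : Primrec x) (hi : Primrec i)
    (hj : Primrec j) : PrimrecPred fun a => SameDigit (b a) (x a) (i a) (j a) :=
  primrecPred_eq (primrec_baseDigit hb hx hi) (primrec_baseDigit hb hx hj)

theorem primrec_fst {β γ : Type*} [Primcodable β] [Primcodable γ] {f : α → β × γ}
    (hf : Primrec f) : Primrec fun a => (f a).1 := Primrec.fst.comp hf

theorem primrec_snd {β γ : Type*} [Primcodable β] [Primcodable γ] {f : α → β × γ}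
    (hf : Primrec f) : Primrec fun a => (f a).2 := Primrec.snd.comp hf

end PrimrecPred

/-! ### The decision procedure -/

namespace CatTable

/-- The number of morphisms. -/
abbrev numArr (c : CatTable) : ℕ := c.2.1.length

/-- The number of the source of the morphism with number `m`. -/
def src (c : CatTable) (m : ℕ) : ℕ := (c.2.1.getD m (0, 0)).1

/-- The number of the target of the morphism with number `m`. -/
def tgt (c : CatTable) (m : ℕ) : ℕ := (c.2.1.getD m (0, 0)).2

/-- The number of the composite of two morphisms in diagrammatic order; it is `0` where the table
has no entry. -/
def cmp (c : CatTable) (m m' : ℕ) : ℕ := (c.2.2[m]?.bind fun row => row[m']?).getD 0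

/-- There is a morphism from the object with number `x` to the one with number `y`. -/
def HasHom (c : CatTable) (x y : ℕ) : Prop := ∃ m < c.numArr, c.src m = x ∧ c.tgt m = y

/-- The morphisms with numbers `f` and `g` are parallel. -/
def Parallel (c : CatTable) (f g : ℕ) : Prop := c.src f = c.src g ∧ c.tgt f = c.tgt g

/-- The parallel morphisms that have the same digit in `s` form a congruence such that all morphisms
of the quotient are monic. -/
def IsMonicCongruence (c : CatTable) (s : ℕ) : Prop :=
  ∀ f < c.numArr, ∀ g < c.numArr, c.Parallel f g → ∀ h < c.numArr,
    (c.tgt h = c.src f → SameDigit c.numArr s f g →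
      SameDigit c.numArr s (c.cmp h f) (c.cmp h g)) ∧
    (c.tgt f = c.src h → SameDigit c.numArr s f g →
      SameDigit c.numArr s (c.cmp f h) (c.cmp g h)) ∧
    (c.tgt f = c.src h → SameDigit c.numArr s (c.cmp f h) (c.cmp g h) →
      SameDigit c.numArr s f g)

/-- The least congruence with monic quotient contains all pairs of parallel morphisms. -/
def ThinReflection (c : CatTable) : Prop :=
  ∀ s < c.numArr ^ c.numArr, c.IsMonicCongruence s →
    ∀ f < c.numArr, ∀ g < c.numArr, c.Parallel f g → SameDigit c.numArr s f g

/-- The predicate `ClopenOn` for the subset `A` of the objects and the set of the objects at which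
`s` has the binary digit `1`. -/
def IsClopenOn (c : CatTable) (A : ℕ → Prop) (s : ℕ) : Prop :=
  ∀ m < c.numArr, A (c.src m) → A (c.tgt m) → SameDigit 2 s (c.src m) (c.tgt m)

/-- The predicate `ExtendsClopens` for the existence of morphisms between objects. -/
def ClopensExtend (c : CatTable) : Prop :=
  ∀ p < c.1, ∀ s < 2 ^ c.1, c.IsClopenOn (fun x => c.HasHom p x ∧ ¬ c.HasHom x p) s →
    ∃ t < 2 ^ c.1, c.IsClopenOn (fun x => ¬ c.HasHom x p) t ∧
      ∀ x < c.1, c.HasHom p x → ¬ c.HasHom x p → baseDigit 2 t x = baseDigit 2 s x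

/-- Connectedness of the described category, which includes that it is nonempty. -/
def Connected (c : CatTable) : Prop :=
  0 < c.1 ∧ ∀ s < 2 ^ c.1, c.IsClopenOn (fun _ => True) s →
    ∀ x < c.1, ∀ y < c.1, SameDigit 2 s x y

section Primrec

variable {α : Type*} [Primcodable α] {c : α → CatTable} {m m' x y : α → ℕ}

theorem primrec_numArr (hc : Primrec c) : Primrec fun a => (c a).numArr :=
  Primrec.list_length.comp (Primrec.fst.comp (Primrec.snd.comp hc))

theorem primrec_src (hc : Primrec c) (hm : Primrec m) : Primrec fun a => (c a).src (m a) :=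
  Primrec.fst.comp ((Primrec.list_getD _).comp (Primrec.fst.comp (Primrec.snd.comp hc)) hm)

theorem primrec_tgt (hc : Primrec c) (hm : Primrec m) : Primrec fun a => (c a).tgt (m a) :=
  Primrec.snd.comp ((Primrec.list_getD _).comp (Primrec.fst.comp (Primrec.snd.comp hc)) hm)

theorem primrec_cmp (hc : Primrec c) (hm : Primrec m) (hm' : Primrec m') :
    Primrec fun a => (c a).cmp (m a) (m' a) :=
  Primrec.option_getD.comp
    (Primrec.option_bind
      (Primrec.list_getElem?.comp (Primrec.snd.comp (Primrec.snd.comp hc)) hm)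
      (Primrec.list_getElem?.comp Primrec.snd (hm'.comp Primrec.fst)).to₂)
    (Primrec.const 0)

theorem primrecPred_parallel (hc : Primrec c) (hm : Primrec m) (hm' : Primrec m') :
    PrimrecPred fun a => (c a).Parallel (m a) (m' a) :=
  (primrecPred_eq (primrec_src hc hm) (primrec_src hc hm')).and
    (primrecPred_eq (primrec_tgt hc hm) (primrec_tgt hc hm'))

theorem primrecPred_hasHom (hc : Primrec c) (hx : Primrec x) (hy : Primrec y) :
    PrimrecPred fun a => (c a).HasHom (x a) (y a) :=
  primrecPred_exists_lt (primrec_numArr hc)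
    ((primrecPred_eq (primrec_src (hc.comp .fst) .snd) (hx.comp .fst)).and
      (primrecPred_eq (primrec_tgt (hc.comp .fst) .snd) (hy.comp .fst)))

theorem primrecPred_isMonicCongruence {s : α → ℕ} (hc : Primrec c) (hs : Primrec s) :
    PrimrecPred fun a => (c a).IsMonicCongruence (s a) := by
  refine primrecPred_forall_lt (primrec_numArr hc) ?_
  apply_rules (transparency := .reducible) (maxDepth := 200) [primrecPred_forall_lt,
    primrecPred_imp, PrimrecPred.and, primrecPred_eq, primrecPred_parallel, primrecPred_sameDigit,
    primrec_numArr, primrec_src, primrec_tgt, primrec_cmp, hc.comp, hs.comp, Primrec.fst,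
    Primrec.snd, primrec_fst, primrec_snd]

theorem primrecPred_isClopenOn {A : α → ℕ → Prop} {s : α → ℕ} (hc : Primrec c)
    (hA : PrimrecPred fun q : α × ℕ => A q.1 q.2) (hs : Primrec s) :
    PrimrecPred fun a => (c a).IsClopenOn (A a) (s a) := by
  have hsrc := primrec_src (hc.comp .fst) (.snd (α := α) (β := ℕ))
  have htgt := primrec_tgt (hc.comp .fst) (.snd (α := α) (β := ℕ))
  exact primrecPred_forall_lt (primrec_numArr hc)
    (primrecPred_imp (hA.comp (.pair .fst hsrc)) (primrecPred_imp (hA.comp (.pair .fst htgt))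
      (primrecPred_sameDigit (.const 2) (hs.comp .fst) hsrc htgt)))

end Primrec

theorem primrecPred_thinReflection : PrimrecPred ThinReflection := by
  have hk : Primrec numArr := primrec_numArr .id
  refine primrecPred_forall_lt (primrec_pow hk hk) ?_
  apply_rules (transparency := .reducible) [primrecPred_forall_lt, primrecPred_imp,
    primrecPred_isMonicCongruence, primrecPred_parallel, primrecPred_sameDigit, primrec_numArr,
    Primrec.fst, Primrec.snd, primrec_fst, primrec_snd]

theorem primrecPred_clopensExtend : PrimrecPred ClopensExtend := by
  refine primrecPred_forall_lt .fst ?_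
  apply_rules (transparency := .reducible) (maxDepth := 100) [primrecPred_forall_lt,
    primrecPred_exists_lt, PrimrecPred.not, primrecPred_imp, PrimrecPred.and,
    primrecPred_isClopenOn, primrecPred_hasHom, primrecPred_eq, primrec_baseDigit, primrec_pow,
    Primrec.const, Primrec.fst, Primrec.snd, primrec_fst, primrec_snd]

theorem primrecPred_connected : PrimrecPred Connected := by
  refine (Primrec.nat_lt.comp (.const 0) .fst).and
    (primrecPred_forall_lt (primrec_pow (.const 2) .fst)
      (primrecPred_imp
        (primrecPred_isClopenOn .fst ⟨fun _ => .isTrue trivial, .const true⟩ .snd) ?_))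
  apply_rules (transparency := .reducible) [primrecPred_forall_lt, primrecPred_sameDigit,
    Primrec.const, Primrec.fst, Primrec.snd, primrec_fst, primrec_snd]

/-! ### Correctness of the decision procedure -/

namespace Presentation

variable {I : Type w} [Category.{w'} I] {c : CatTable}

/-- The number of a morphism. -/
def num (P : c.Presentation I) {X Y : I} (f : X ⟶ Y) : Fin c.numArr := P.arr ⟨X, Y, f⟩

theorem src_num (P : c.Presentation I) {X Y : I} (f : X ⟶ Y) : c.src (P.num f) = P.obj X := by
  have := congrArg Prod.fst (P.endpoints f)
  simpa [src, num, List.getD_eq_getElem] using this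

theorem tgt_num (P : c.Presentation I) {X Y : I} (f : X ⟶ Y) : c.tgt (P.num f) = P.obj Y := by
  have := congrArg Prod.snd (P.endpoints f)
  simpa [tgt, num, List.getD_eq_getElem] using this

theorem cmp_num (P : c.Presentation I) {X Y Z : I} (f : X ⟶ Y) (g : Y ⟶ Z) :
    c.cmp (P.num f) (P.num g) = P.num (f ≫ g) := by
  unfold cmp num
  rw [P.comp f g]
  rfl

theorem exists_num_eq (P : c.Presentation I) {m : ℕ} (hm : m < c.numArr) :
    ∃ (X Y : I) (f : X ⟶ Y), P.num f = m :=
  ⟨_, _, (P.arr.symm ⟨m, hm⟩).2.2, by simp [num]⟩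

theorem forall_num_iff (P : c.Presentation I) {p : ℕ → Prop} :
    (∀ m < c.numArr, p m) ↔ ∀ ⦃X Y : I⦄ (f : X ⟶ Y), p (P.num f) :=
  ⟨fun h _ _ f => h _ (P.num f).2, fun h m hm => by
    obtain ⟨X, Y, f, rfl⟩ := P.exists_num_eq hm
    exact h f⟩

theorem forall_obj_iff (P : c.Presentation I) {p : ℕ → Prop} :
    (∀ x < c.1, p x) ↔ ∀ X : I, p (P.obj X) :=
  ⟨fun h X => h _ (P.obj X).2, fun h x hx => by simpa using h (P.obj.symm ⟨x, hx⟩)⟩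

theorem obj_val_inj (P : c.Presentation I) {X Y : I} : (P.obj X : ℕ) = P.obj Y ↔ X = Y :=
  Fin.val_inj.trans P.obj.injective.eq_iff

theorem parallel_num_iff (P : c.Presentation I) {X Y X' Y' : I} (f : X ⟶ Y) (g : X' ⟶ Y') :
    c.Parallel (P.num f) (P.num g) ↔ X = X' ∧ Y = Y' := by
  rw [Parallel, P.src_num, P.src_num, P.tgt_num, P.tgt_num, P.obj_val_inj, P.obj_val_inj]

theorem forall_parallel_iff (P : c.Presentation I) {p : ℕ → ℕ → Prop} :
    (∀ f < c.numArr, ∀ g < c.numArr, c.Parallel f g → p f g) ↔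
      ∀ ⦃X Y : I⦄ (f g : X ⟶ Y), p (P.num f) (P.num g) := by
  simp only [P.forall_num_iff, P.parallel_num_iff]
  exact ⟨fun h X Y f g => h f g ⟨rfl, rfl⟩, by rintro h X Y f _ _ g ⟨rfl, rfl⟩; exact h f g⟩

theorem hasHom_iff (P : c.Presentation I) (X Y : I) :
    c.HasHom (P.obj X) (P.obj Y) ↔ Nonempty (X ⟶ Y) := by
  constructor
  · rintro ⟨m, hm, hs, ht⟩
    obtain ⟨X', Y', f, rfl⟩ := P.exists_num_eq hm
    rw [P.src_num, P.obj_val_inj] at hs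
    rw [P.tgt_num, P.obj_val_inj] at ht
    exact ⟨eqToHom hs.symm ≫ f ≫ eqToHom ht⟩
  · rintro ⟨f⟩
    exact ⟨_, (P.num f).2, P.src_num f, P.tgt_num f⟩

theorem finite_arr (P : c.Presentation I) : Finite (Σ X Y : I, X ⟶ Y) := .of_equiv _ P.arr.symm

/-- The relation on parallel morphisms of having the same digit in `s`. -/
def homRel (P : c.Presentation I) (s : ℕ) : HomRel I :=
  fun _ _ f g => SameDigit c.numArr s (P.num f) (P.num g)

theorem isMonicCongruence_iff (P : c.Presentation I) (s : ℕ) : c.IsMonicCongruence s ↔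
    ∃ _ : Congruence (P.homRel s),
      ∀ ⦃A B : CategoryTheory.Quotient (P.homRel s)⦄ (h : A ⟶ B), Mono h := by
  rw [IsMonicCongruence, P.forall_parallel_iff]
  simp only [P.forall_num_iff, P.src_num, P.tgt_num, P.obj_val_inj]
  constructor
  · intro h
    have hc : Congruence (P.homRel s) :=
      { equivalence := ⟨fun _ => rfl, Eq.symm, Eq.trans⟩
        comp_left := fun k f g hfg => by
          simpa only [homRel, P.cmp_num] using (h f g k).1 rfl hfg
        comp_right := fun k hfg => by
          simpa only [homRel, P.cmp_num] using (h _ _ k).2.1 rfl hfg }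
    refine ⟨hc, (forall_mono_quotient_iff _).2 fun X Y Z f g k hk => (h f g k).2.2 rfl ?_⟩
    rwa [P.cmp_num, P.cmp_num]
  · rintro ⟨hc, hm⟩ X Y f g A B k
    refine ⟨?_, ?_, ?_⟩
    · rintro rfl hfg
      rw [P.cmp_num, P.cmp_num]
      exact hc.comp_left k hfg
    · rintro rfl hfg
      rw [P.cmp_num, P.cmp_num]
      exact hc.comp_right k hfg
    · rintro rfl hfg
      rw [P.cmp_num, P.cmp_num] at hfg
      exact (forall_mono_quotient_iff _).1 hm f g k hfg

theorem exists_homRel_eq (P : c.Presentation I) (r : HomRel I) [Congruence r] :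
    ∃ s < c.numArr ^ c.numArr, P.homRel s = r := by
  let φ : (Σ X Y : I, X ⟶ Y) → Σ A B : CategoryTheory.Quotient r, A ⟶ B := fun f =>
    ⟨_, _, (CategoryTheory.Quotient.functor r).map f.2.2⟩
  obtain ⟨s, hs, h⟩ := exists_sameDigit_iff (Setoid.ker (φ ∘ P.arr.symm))
  refine ⟨s, hs, ?_⟩
  funext X Y f g
  apply propext
  refine (h _ _).trans ?_
  simp only [num, Setoid.ker_def, Function.comp_apply, Equiv.symm_apply_apply]
  rw [← CategoryTheory.Quotient.functor_map_eq_iff r]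
  simp [φ]

theorem thinReflection_iff (P : c.Presentation I) :
    c.ThinReflection ↔ Quiver.IsThin (MonicReflection I) := by
  rw [MonicReflection.isThin_iff, ThinReflection]
  simp only [P.forall_parallel_iff, P.isMonicCongruence_iff]
  constructor
  · intro h X Y f g r hr hm
    obtain ⟨s, hs, rfl⟩ := P.exists_homRel_eq r
    exact h s hs ⟨hr, hm⟩ f g
  · rintro h s - ⟨hr, hm⟩ X Y f g
    exact h f g _ hr hm

/-- The set of the objects at which `s` has the binary digit `1`. -/
def objSet (P : c.Presentation I) (s : ℕ) : Set I := {X | baseDigit 2 s (P.obj X) = 1}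

theorem exists_objSet_eq (P : c.Presentation I) (S : Set I) : ∃ s < 2 ^ c.1, P.objSet s = S := by
  obtain ⟨s, hs, h⟩ := exists_baseDigit_two_eq_one_iff (P.obj.symm ⁻¹' S)
  exact ⟨s, hs, Set.ext fun X => (h (P.obj X)).trans (by simp)⟩

theorem isClopenOn_iff (P : c.Presentation I) (A : ℕ → Prop) (s : ℕ) : c.IsClopenOn A s ↔
    ClopenOn (fun X Y : I => Nonempty (X ⟶ Y)) {X | A (P.obj X)} (P.objSet s) := by
  simp only [IsClopenOn, P.forall_num_iff, P.src_num, P.tgt_num, SameDigit, baseDigit_two_eq_iff]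
  exact ⟨fun h X hX Y hY ⟨f⟩ => h f hX hY, fun h X Y f hX hY => h X hX Y hY ⟨f⟩⟩

theorem clopensExtend_iff (P : c.Presentation I) :
    c.ClopensExtend ↔ ExtendsClopens fun X Y : I => Nonempty (X ⟶ Y) := by
  simp only [ClopensExtend, ExtendsClopens, P.forall_obj_iff, P.isClopenOn_iff,
    P.hasHom_iff, baseDigit_two_eq_iff]
  constructor
  · intro h X S hS
    obtain ⟨s, hs, rfl⟩ := P.exists_objSet_eq S
    obtain ⟨t, -, ht, hts⟩ := h X s hs hS
    exact ⟨P.objSet t, ht, hts⟩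
  · intro h X s _ hS
    obtain ⟨T, hT, hTS⟩ := h X (P.objSet s) hS
    obtain ⟨t, ht, rfl⟩ := P.exists_objSet_eq T
    exact ⟨t, ht, hT, hTS⟩

theorem connected_iff (P : c.Presentation I) : c.Connected ↔ CategoryTheory.IsConnected I := by
  simp only [Connected, P.forall_obj_iff, P.isClopenOn_iff, SameDigit, baseDigit_two_eq_iff]
  constructor
  · rintro ⟨h0, h⟩
    refine IsConnected.of_induct (j₀ := P.obj.symm ⟨0, h0⟩) fun p hX hp Y => ?_
    obtain ⟨s, hs, rfl⟩ := P.exists_objSet_eq p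
    exact (h s hs (fun X _ Y _ ⟨f⟩ => hp f) _ Y).1 hX
  · intro hI
    refine ⟨(P.obj hI.is_nonempty.some).pos, fun s _ h X Y => ?_⟩
    exact (constant_of_preserves_morphisms (· ∈ P.objSet s)
      (fun A B f => propext (h A trivial B trivial ⟨f⟩)) X Y).to_iff

end Presentation

end CatTable

theorem corollary6p1 :
    ∃ d d' : CatTable → Bool, Computable d ∧ Computable d' ∧
      ∀ (I : Type w) [Category.{w'} I] (c : CatTable), Nonempty (c.Presentation I) →
        (d c = true ↔ UpwardSimplyConnected I) ∧
        (d c = true ↔ CoconesFromAPJEP.{w, w', u, v} I) ∧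
        (d' c = true ↔ CoconesFromAP.{w, w', u, v} I) ∧
        (UpwardSimplyConnected I ↔
          ∃ _ : Quiver.IsThin (MonicReflection I), ForestLike (ThinSkeleton (MonicReflection I))) := by
  classical
  have hp := CatTable.primrecPred_thinReflection.and CatTable.primrecPred_clopensExtend
  refine ⟨fun c => decide (c.ThinReflection ∧ c.ClopensExtend),
    fun c => decide ((c.ThinReflection ∧ c.ClopensExtend) ∧ c.Connected), hp.decide.to_comp,
    (hp.and CatTable.primrecPred_connected).decide.to_comp, ?_⟩
  rintro I _ c ⟨P⟩
  have := P.finite_arr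
  have key := UpwardSimplyConnected.tfae.{w, w', u, v} (I := I)
  have hd : c.ThinReflection ∧ c.ClopensExtend ↔ UpwardSimplyConnected I := by
    rw [P.thinReflection_iff, P.clopensExtend_iff]
    exact key.out 4 0
  simp only [decide_eq_true_iff, hd, P.connected_iff, true_and]
  exact ⟨key.out 0 1, coconesFromAP_iff.symm, key.out 0 2⟩
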